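/- Let $\mathcal X,\mathcal K$ be real Hilbert spaces; products of them carry the Hilbert product structure. $\Gamma_0(\mathcal H)$ denotes the proper lower semicontinuous convex functions $\mathcal H\to(-\infty,\infty]$, $\operatorname{dom} f=\{f<\infty\}$, $\operatorname{prox}_f(x)$ is the (unique) minimizer of $f+\frac12\|\cdot-x\|^2$ for $f\in\Gamma_0(\mathcal H)$, and $\operatorname{Fix}(T)=\{w: Tw=w\}$. For a convex set $C$, $\operatorname{sri}(C)$ is the set of $x\in C$ for which $\{t(y-x): t>0,\ y\in C\}$ equals the closed linear span of $C-x$. Let $f\in\Gamma_0(\mathcal X)$, $g\in\Gamma_0(\mathcal K)$ and let $A:\mathcal X\to\mathcal K$ be bounded and linear, such that $$\mathcal S_p:=\operatorname*{argmin}_{x\in\mathcal X}\,[f(x)+g(Ax)]\neq\varnothing,\qquad 0\in\operatorname{sri}(\operatorname{dom} g-A\operatorname{dom} f),$$ and let $\mathfrak u>0$ satisfy $\|\check A\|_{\rm op}\le 1/\mathfrak u$, where $\check A:\mathcal X\times\mathcal K\to\mathcal K$, $\check A(x,y)=Ax-y$. Let $\Psi\in\Gamma_0(\mathcal X)$ be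 real-valued and Gâteaux differentiable on $\mathcal X$, with $\nabla\Psi$ Lipschitz continuous and strongly monotone on $\mathcal X$. Define $\mathbf T_{\rm LAL}:\mathcal X\times\mathcal K\times\mathcal K\to\mathcal X\times\mathcal K\times\mathcal K$, $(x,y,\nu)\mapsto(x_T,y_T,\nu_T)$, by $$x_T=\operatorname{prox}_f\big(x-\mathfrak u^2(A^*Ax-A^*y)+\mathfrak uA^*\nu\big),\quad y_T=\operatorname{prox}_g\big(y-\mathfrak u^2(-Ax+y)-\mathfrak u\nu\big),\quad \nu_T=\nu-\mathfrak u(Ax_T-y_T),$$ and let $\Xi(x,y,\nu)=x$. Then the following hold. (i) $\mathbf T_{\rm LAL}$ is nonexpansive and $\mathcal S_p=\Xi(\operatorname{Fix}(\mathbf T_{\rm LAL}))$. (ii) The problem of minimizing $\Psi$ over $\mathcal S_p$ has exactly one solution $x^\star$. (iii) Let $\alpha\in(0,1]$, $\eta_{xy},\eta_\nu>0$, $T_\alpha:=(1-\alpha)\mathrm I+\alpha\mathbf T_{\rm LAL}$ and $$\Theta^{\rm reg}(x,y,\nu):=\Psi(x)+\tfrac{\eta_{xy}}2\|Ax-y\|^2+\tfrac{\eta_\nu}2\|\nu\|^2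 .$$ Then $T_\alpha$ is nonexpansive, $\mathcal S_p=\Xi(\operatorname{Fix}(T_\alpha))$, $\{x^\star\}=\Xi\big(\operatorname{argmin}_{\operatorname{Fix}(T_\alpha)}\Theta^{\rm reg}\big)$, and $\Theta^{\rm reg}$ is Gâteaux differentiable with Lipschitz continuous and strongly monotone gradient. For every real sequence $(\lambda_{n+1})_{n\in\mathbb N}$ the hybrid steepest descent iteration $w_{n+1}=T_\alpha w_n-\lambda_{n+1}\nabla\Theta^{\rm reg}(T_\alpha w_n)$ with $w_n=(x_n,y_n,\nu_n)$ is the iteration $$\begin{aligned}(x_{n+1/2},y_{n+1/2},\nu_{n+1/2})&=(1-\alpha)(x_n,y_n,\nu_n)+\alpha\,\mathbf T_{\rm LAL}(x_n,y_n,\nu_n),\\ x_{n+1}&=x_{n+1/2}-\lambda_{n+1}\big(\nabla\Psi(x_{n+1/2})+\eta_{xy}A^*(Ax_{n+1/2}-y_{n+1/2})\big),\\ y_{n+1}&=y_{n+1/2}+\lambda_{n+1}\eta_{xy}(Ax_{n+1/2}-y_{n+1/2}),\\ \nu_{n+1}&=\nu_{n+1/2}-\lambda_{n+1}\eta_\nu\,\nu_{n+1/2}.\end{aligned}$$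 (iv) For all $\alpha\in(0,1]$, $\eta_{xy},\eta_\nu>0$ and every initial point $(x_0,y_0,\nu_0)\in\mathcal X\times\mathcal K\times\mathcal K$, the sequence $(x_n)$ generated by this iteration converges strongly to $x^\star$, provided that either $(\lambda_{n+1})_{n\in\mathbb N}\subset[0,\infty)$ satisfies (W1) $\lambda_n\to0$, (W2) $\sum_{n\in\mathbb N}\lambda_{n+1}=\infty$, (W3) $\sum_{n\in\mathbb N}|\lambda_{n+1}-\lambda_{n+2}|<\infty$, or $(\lambda_{n+1})_{n\in\mathbb N}\subset(0,\infty)$ satisfies (L1) $\lambda_n\to0$, (L2) $\sum_{n\in\mathbb N}\lambda_{n+1}=\infty$, (L3) $(\lambda_n-\lambda_{n+1})\lambda_{n+1}^{-2}\to0$. -/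

import Mathlib

open scoped Pointwise Topology NNReal
open Filter Set

noncomputable section

namespace LAL

/-- The set of minimizers of `φ` over `S`. -/
def argminOn {E β : Type*} [Preorder β] (φ : E → β) (S : Set E) : Set E :=
  {x ∈ S | IsMinOn φ S x}

section Convex

variable {E : Type*} [NormedAddCommGroup E] [InnerProductSpace ℝ E]

/-- Effective domain. -/
def effDom (f : E → EReal) : Set E := {x | f x < ⊤}

/-- The class `Γ₀(E)` of proper lower semicontinuous convex functions `E → (-∞, ∞]`. -/
structure IsGamma0 (f : E → EReal) : Prop where
  ne_bot : ∀ x, f x ≠ ⊥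
  proper : (effDom f).Nonempty
  lsc : LowerSemicontinuous f
  convex : ∀ x ∈ effDom f, ∀ y ∈ effDom f, ∀ t : ℝ, 0 < t → t < 1 →
    f (t • x + (1 - t) • y) ≤ (t : EReal) * f x + ((1 - t : ℝ) : EReal) * f y

/-- The function `y ↦ f y + ‖y - x‖² / 2`. -/
def proxObjective (f : E → EReal) (x y : E) : EReal :=
  f y + ((‖y - x‖ ^ 2 / 2 : ℝ) : EReal)

/-- Proximity operator: the minimizer of `y ↦ f y + ‖y - x‖² / 2`. -/
def prox (f : E → EReal) (x : E) : E :=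
  Classical.epsilon fun p => p ∈ argminOn (proxObjective f x) univ

/-- Conical hull `{t • x | t > 0, x ∈ C}`. -/
def coneHull (C : Set E) : Set E := {v | ∃ t : ℝ, 0 < t ∧ ∃ x ∈ C, v = t • x}

/-- Strong relative interior. -/
def sri (C : Set E) : Set E :=
  {x ∈ C | coneHull ((fun y => y - x) '' C)
    = closure (Submodule.span ℝ ((fun y => y - x) '' C) : Set E)}

/-- `a` is the Gâteaux gradient of `φ` at `x`. -/
def HasGateauxGradientAt (φ : E → ℝ) (a x : E) : Prop :=
  ∀ h : E, HasLineDerivAt ℝ φ (inner ℝ a h) x h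

/-- Strong monotonicity over the whole space. -/
def StronglyMonotone (G : E → E) : Prop :=
  ∃ η : ℝ, 0 < η ∧ ∀ x y, η * ‖x - y‖ ^ 2 ≤ inner ℝ (G x - G y) (x - y)

/-- The operator `(1 - α) I + α T`. -/
def relax (α : ℝ) (T : E → E) (w : E) : E := (1 - α) • w + α • T w

/-- Hybrid steepest descent method:
`w (n+1) = T (w n) - lam (n+1) • G (T (w n))`, where `G` is the gradient of the objective. -/
def hsdm (T G : E → E) (lam : ℕ → ℝ) (w₀ : E) : ℕ → E
  | 0 => w₀
  | n + 1 => T (hsdm T G lam w₀ n) - lam (n + 1) • G (T (hsdm T G lam w₀ n))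

end Convex

/-- Conditions (W1)-(W3) on the step sizes `lam 1, lam 2, …`, with `lam (n+1) ≥ 0`. -/
structure StepW (lam : ℕ → ℝ) : Prop where
  nonneg : ∀ n, 0 ≤ lam (n + 1)
  w1 : Tendsto lam atTop (𝓝 0)
  w2 : Tendsto (fun N => ∑ n ∈ Finset.range N, lam (n + 1)) atTop atTop
  w3 : Summable fun n => |lam (n + 1) - lam (n + 2)|

/-- Conditions (L1)-(L3) on the step sizes `lam 1, lam 2, …`, with `lam (n+1) > 0`. -/
structure StepL (lam : ℕ → ℝ) : Prop where
  pos : ∀ n, 0 < lam (n + 1)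
  l1 : Tendsto lam atTop (𝓝 0)
  l2 : Tendsto (fun N => ∑ n ∈ Finset.range N, lam (n + 1)) atTop atTop
  l3 : Tendsto (fun n => (lam n - lam (n + 1)) / lam (n + 1) ^ 2) atTop (𝓝 0)

section Product

/-- The Hilbert space `X × K × K` (as the Hilbert product of `X × K` and `K`). -/
abbrev Triple (X K : Type*) : Type _ := WithLp 2 (WithLp 2 (X × K) × K)

variable {X K : Type*}

def triple (x : X) (y ν : K) : Triple X K := WithLp.toLp 2 (WithLp.toLp 2 (x, y), ν)

/-- The components of `(x, y, ν)`; `xPart` is the projection `X × K × K → X`. -/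
def xPart (w : Triple X K) : X := w.fst.fst

def yPart (w : Triple X K) : K := w.fst.snd

def nuPart (w : Triple X K) : K := w.snd

variable [NormedAddCommGroup X] [InnerProductSpace ℝ X]
  [NormedAddCommGroup K] [InnerProductSpace ℝ K]

/-- The bounded linear operator `(x, y) ↦ A x - y` on the Hilbert product `X × K`. -/
def checkA (A : X →L[ℝ] K) : WithLp 2 (X × K) →L[ℝ] K :=
  A ∘L WithLp.fstL 2 ℝ X K - WithLp.sndL 2 ℝ X K

/-- The solution set `S_p` of the first stage problem: minimizers of `f + g ∘ A` over `X`. -/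
def solSet (f : X → EReal) (g : K → EReal) (A : X →L[ℝ] K) : Set X :=
  argminOn (fun x => f x + g (A x)) univ

/-- The qualification condition `0 ∈ sri (dom g - A (dom f))`. -/
def Qualified (f : X → EReal) (g : K → EReal) (A : X →L[ℝ] K) : Prop :=
  (0 : K) ∈ sri (effDom g - A '' effDom f)

/-- The regularized objective
`(x, y, ν) ↦ Ψ x + (ηxy / 2) ‖A x - y‖² + (ην / 2) ‖ν‖²`. -/
def thetaReg (Ψ : X → ℝ) (A : X →L[ℝ] K) (ηxy ην : ℝ) (w : Triple X K) : ℝ :=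
  Ψ (xPart w) + ηxy / 2 * ‖checkA A w.fst‖ ^ 2 + ην / 2 * ‖nuPart w‖ ^ 2

variable [CompleteSpace X] [CompleteSpace K]

/-- The LAL operator on `X × K × K`. -/
def lalOp (f : X → EReal) (g : K → EReal) (A : X →L[ℝ] K) (u : ℝ) (w : Triple X K) :
    Triple X K :=
  let x := xPart w
  let y := yPart w
  let ν := nuPart w
  let xT := prox f (x - u ^ 2 • (A.adjoint (A x) - A.adjoint y) + u • A.adjoint ν)
  let yT := prox g (y - u ^ 2 • (-(A x) + y) - u • ν)
  triple xT yT (ν - u • (A xT - yT))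

/-- The iteration for `(x n, y n, ν n)`; `gradΨ` is the gradient of `Ψ`, and `h` is the
intermediate point with index `n + 1/2`. -/
def lalHSDM (f : X → EReal) (g : K → EReal) (A : X →L[ℝ] K) (u : ℝ) (gradΨ : X → X)
    (α ηxy ην : ℝ) (lam : ℕ → ℝ) (w₀ : Triple X K) : ℕ → Triple X K
  | 0 => w₀
  | n + 1 =>
    let w := lalHSDM f g A u gradΨ α ηxy ην lam w₀ n
    let h := (1 - α) • w + α • lalOp f g A u w
    let r := A (xPart h) - yPart h
    triple
      (xPart h - lam (n + 1) • (gradΨ (xPart h) + ηxy • A.adjoint r))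
      (yPart h + (lam (n + 1) * ηxy) • r)
      (nuPart h - (lam (n + 1) * ην) • nuPart h)

end Product

end LAL

end

open LAL

/-! Two facts carry the theorem: fixed points of `lalOp` encode primal solutions together with
multipliers, and the hybrid steepest descent method converges strongly for any nonexpansive map with
a fixed point.

The multiplier update forces `y = A x` at a fixed point, and the two proximal equations then become
the KKT conditions (`mem_fixedPoints_lalOp_iff`). Every KKT point is a solution by adding two
subgradient inequalities. Conversely, every solution needs a multiplier. A Baire-type convex open
mapping argument turns the `sri` condition into a linear lower bound for the value function of the
perturbed problem (`Qualified.exists_lower_bound`), and Hahn-Banach separation turns that bound into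
a subgradient of the value function at the origin (`Qualified.exists_multiplier`). Nonexpansiveness
of `lalOp` follows by adding the firm nonexpansiveness inequalities of the two proximity operators
and the norm bound on `checkA A`.

A multiplier for one solution serves all solutions (`IsKKT.of_mem_solSet`). On the fixed point set
the coupling term of `thetaReg` vanishes, so with the multiplier held fixed `thetaReg` is `Ψ` plus a
constant. Its unique minimizer therefore projects to the unique minimizer of `Ψ` over the solution
set, whatever the weights are.

For convergence (`tendsto_of_hybrid_recursion`), the iterates are bounded and asymptotically
regular. The variational inequality at the limit point then controls the inner product in a
contraction recursion for the squared distance. That control is obtained from the strongly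
convergent path of regularized fixed points, without weak compactness. -/

namespace LAL

/-! ### Subgradients and proximity operators. -/

section Subgradient

variable {E : Type*} [NormedAddCommGroup E] [InnerProductSpace ℝ E]

/-- The vector `v` is a subgradient of `f` at the point `p` of its effective domain. -/
def IsSubgradient (f : E → EReal) (p v : E) : Prop :=
  p ∈ effDom f ∧ ∀ y ∈ effDom f, (f p).toReal + inner ℝ v (y - p) ≤ (f y).toReal

namespace IsGamma0

variable {f : E → EReal}

theorem coe_toReal (hf : IsGamma0 f) {x : E} (hx : x ∈ effDom f) : ((f x).toReal : EReal) = f x :=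
  EReal.coe_toReal (ne_of_lt hx) (hf.ne_bot x)

theorem convex_toReal (hf : IsGamma0 f) {x y : E} (hx : x ∈ effDom f) (hy : y ∈ effDom f) {t : ℝ}
    (ht₀ : 0 ≤ t) (ht₁ : t ≤ 1) :
    t • x + (1 - t) • y ∈ effDom f ∧
      (f (t • x + (1 - t) • y)).toReal ≤ t * (f x).toReal + (1 - t) * (f y).toReal := by
  rcases ht₀.eq_or_lt with rfl | ht₀
  · simpa using hy
  rcases ht₁.eq_or_lt with rfl | ht₁
  · simpa using hx
  have h := hf.convex x hx y hy t ht₀ ht₁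
  rw [← hf.coe_toReal hx, ← hf.coe_toReal hy, ← EReal.coe_mul, ← EReal.coe_mul,
    ← EReal.coe_add] at h
  have hd : t • x + (1 - t) • y ∈ effDom f := h.trans_lt (EReal.coe_lt_top _)
  refine ⟨hd, ?_⟩
  rw [← hf.coe_toReal hd] at h
  exact_mod_cast h

theorem le_coe_iff (hf : IsGamma0 f) {x : E} {c : ℝ} :
    f x ≤ c ↔ x ∈ effDom f ∧ (f x).toReal ≤ c := by
  constructor
  · intro h
    have hd : x ∈ effDom f := h.trans_lt (EReal.coe_lt_top _)
    refine ⟨hd, ?_⟩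
    rw [← hf.coe_toReal hd] at h
    exact_mod_cast h
  · rintro ⟨hd, h⟩
    rw [← hf.coe_toReal hd]
    exact_mod_cast h

theorem isClosed_sublevel (hf : IsGamma0 f) (c : ℝ) :
    IsClosed {x | x ∈ effDom f ∧ (f x).toReal ≤ c} := by
  have h := hf.lsc.isClosed_preimage (c : EReal)
  convert h using 1
  ext x
  exact hf.le_coe_iff.symm

theorem convex_sublevel (hf : IsGamma0 f) (c : ℝ) :
    Convex ℝ {x | x ∈ effDom f ∧ (f x).toReal ≤ c} := by
  rintro x ⟨hx, hxc⟩ y ⟨hy, hyc⟩ a b ha hb hab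
  obtain rfl : b = 1 - a := by linarith
  obtain ⟨h₁, h₂⟩ := hf.convex_toReal hx hy ha (by linarith)
  refine ⟨h₁, h₂.trans ?_⟩
  nlinarith

/-- A function in `Γ₀` is minorized by `c - C * ‖· - x₀‖`. -/
theorem exists_lower_bound (hf : IsGamma0 f) {x₀ : E} (hx₀ : x₀ ∈ effDom f) :
    ∃ C : ℝ, 0 ≤ C ∧ ∀ y ∈ effDom f, (f x₀).toReal - 1 - C * ‖y - x₀‖ ≤ (f y).toReal := by
  have hlt : (((f x₀).toReal - 1 : ℝ) : EReal) < f x₀ := by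
    rw [← hf.coe_toReal hx₀]
    exact_mod_cast sub_one_lt _
  have hev := hf.lsc x₀ _ hlt
  obtain ⟨r, hr, hball⟩ := Metric.eventually_nhds_iff.1 hev
  have hin : ∀ y ∈ effDom f, dist y x₀ < r → (f x₀).toReal - 1 ≤ (f y).toReal := by
    intro y hy hd
    have : (((f x₀).toReal - 1 : ℝ) : EReal) < f y := hball hd
    rw [← hf.coe_toReal hy] at this
    exact (EReal.coe_lt_coe_iff.1 this).le
  refine ⟨2 / r, by positivity, fun y hy => ?_⟩
  by_cases hd : dist y x₀ < r
  · have h₁ := hin y hy hd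
    have h₂ : 0 ≤ 2 / r * ‖y - x₀‖ := by positivity
    linarith
  · rw [dist_eq_norm, not_lt] at hd
    have hpos : 0 < ‖y - x₀‖ := hr.trans_le hd
    -- The point of the segment from `x₀` to `y` at distance `r / 2` from `x₀` lies in the ball
    -- where lower semicontinuity gives the bound; convexity carries the bound out to `y`.
    set t : ℝ := r / (2 * ‖y - x₀‖) with ht
    have ht₀ : 0 < t := by positivity
    have ht₁ : t ≤ 1 := by
      rw [ht, div_le_one (by positivity)]; linarith
    obtain ⟨hm, hle⟩ := hf.convex_toReal hy hx₀ ht₀.le ht₁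
    have hnear : dist (t • y + (1 - t) • x₀) x₀ < r := by
      have : t • y + (1 - t) • x₀ - x₀ = t • (y - x₀) := by module
      rw [dist_eq_norm, this, norm_smul, Real.norm_of_nonneg ht₀.le, ht]
      field_simp
      linarith
    have h₁ := hin _ hm hnear
    have h₂ : 2 / r * ‖y - x₀‖ * t = 1 := by rw [ht]; field_simp
    have h₃ : t * ((f x₀).toReal - 2 / r * ‖y - x₀‖) ≤ t * (f y).toReal := by
      nlinarith
    have := le_of_mul_le_mul_left h₃ ht₀
    linarith

end IsGamma0

/-- Compare `p` with `t • y + (1 - t) • p` and divide by `t`. The quadratic error is `t * D`, and an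
explicit `t` with `t * D ≤ ε` replaces the limit `t → 0`. -/
theorem isSubgradient_of_isMin {f : E → EReal} (hf : IsGamma0 f) {x p : E} (hp : p ∈ effDom f)
    (hmin : ∀ y ∈ effDom f,
      (f p).toReal + ‖p - x‖ ^ 2 / 2 ≤ (f y).toReal + ‖y - x‖ ^ 2 / 2) :
    IsSubgradient f p (x - p) := by
  refine ⟨hp, fun y hy => ?_⟩
  refine le_of_forall_pos_le_add fun ε hε => ?_
  set D := ‖y - p‖ ^ 2 / 2 with hD
  have hD₀ : 0 ≤ D := by positivity
  set t : ℝ := ε / (ε + D) with ht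
  have ht₀ : 0 < t := by positivity
  have ht₁ : t ≤ 1 := by rw [ht, div_le_one (by positivity)]; linarith
  have htD : t * D ≤ ε := by
    rw [ht, div_mul_eq_mul_div, div_le_iff₀ (by positivity)]
    nlinarith
  obtain ⟨hm, hle⟩ := hf.convex_toReal hy hp ht₀.le ht₁
  have h := hmin _ hm
  have hexp : ‖t • y + (1 - t) • p - x‖ ^ 2
      = ‖p - x‖ ^ 2 - 2 * t * inner ℝ (x - p) (y - p) + t ^ 2 * ‖y - p‖ ^ 2 := by
    have : t • y + (1 - t) • p - x = (p - x) + t • (y - p) := by module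
    rw [this, norm_add_sq_real, inner_smul_right, norm_smul, mul_pow, Real.norm_eq_abs, sq_abs,
      ← neg_sub x p, inner_neg_left]
    ring
  rw [hexp] at h
  have h₃ : t * ((f p).toReal + inner ℝ (x - p) (y - p)) ≤ t * ((f y).toReal + ε) := by
    have : t * (t * D) ≤ t * ε := by gcongr
    have h4 : t ^ 2 * ‖y - p‖ ^ 2 = 2 * (t * (t * D)) := by rw [hD]; ring
    nlinarith
  exact le_of_mul_le_mul_left h₃ ht₀

theorem IsSubgradient.add_sq_le {f : E → EReal} {x p : E} (h : IsSubgradient f p (x - p))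
    {y : E} (hy : y ∈ effDom f) :
    (f p).toReal + ‖p - x‖ ^ 2 / 2 + ‖y - p‖ ^ 2 / 2 ≤ (f y).toReal + ‖y - x‖ ^ 2 / 2 := by
  have h₁ := h.2 y hy
  have h₂ : ‖y - x‖ ^ 2 = ‖p - x‖ ^ 2 - 2 * inner ℝ (x - p) (y - p) + ‖y - p‖ ^ 2 := by
    have : y - x = (p - x) + (y - p) := by module
    rw [this, norm_add_sq_real, ← neg_sub x p, inner_neg_left]
    ring
  linarith

theorem IsSubgradient.inner_sub_nonneg {f : E → EReal} {p q v w : E} (hp : IsSubgradient f p v)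
    (hq : IsSubgradient f q w) : 0 ≤ inner ℝ (v - w) (p - q) := by
  have h₁ := hp.2 q hq.1
  have h₂ := hq.2 p hp.1
  rw [← neg_sub p q, inner_neg_right] at h₁
  rw [inner_sub_left]
  linarith

theorem mem_argminOn_proxObjective_iff {f : E → EReal} (hf : IsGamma0 f) (x p : E) :
    p ∈ argminOn (proxObjective f x) univ ↔ IsSubgradient f p (x - p) := by
  have hco : ∀ y ∈ effDom f,
      proxObjective f x y = (((f y).toReal + ‖y - x‖ ^ 2 / 2 : ℝ) : EReal) := by
    intro y hy
    rw [proxObjective, EReal.coe_add, hf.coe_toReal hy]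
  constructor
  · rintro ⟨-, hmin⟩
    have hle : ∀ y, proxObjective f x p ≤ proxObjective f x y := fun y => hmin (mem_univ y)
    have hp : p ∈ effDom f := by
      obtain ⟨x₀, hx₀⟩ := hf.proper
      have h := hle x₀
      rw [hco x₀ hx₀] at h
      by_contra hcon
      have htop : f p = ⊤ := by simpa [effDom] using hcon
      rw [proxObjective, htop, EReal.top_add_coe] at h
      exact absurd (h.trans_lt (EReal.coe_lt_top _)) (lt_irrefl _)
    refine isSubgradient_of_isMin hf hp fun y hy => ?_
    have h := hle y
    rw [hco p hp, hco y hy] at h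
    exact_mod_cast h
  · intro h
    refine ⟨mem_univ _, fun y _ => ?_⟩
    change proxObjective f x p ≤ proxObjective f x y
    by_cases hy : y ∈ effDom f
    · rw [hco p h.1, hco y hy]
      have := h.add_sq_le hy
      have h0 : 0 ≤ ‖y - p‖ ^ 2 / 2 := by positivity
      exact_mod_cast (by linarith :
        (f p).toReal + ‖p - x‖ ^ 2 / 2 ≤ (f y).toReal + ‖y - x‖ ^ 2 / 2)
    · have htop : f y = ⊤ := by simpa [effDom] using hy
      rw [proxObjective.eq_def f x y, htop, EReal.top_add_coe]
      exact le_top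

theorem IsSubgradient.eq_of_sub {f : E → EReal} {x p q : E} (hp : IsSubgradient f p (x - p))
    (hq : IsSubgradient f q (x - q)) : p = q := by
  have h := hp.inner_sub_nonneg hq
  have e : x - p - (x - q) = -(p - q) := by abel
  rw [e, inner_neg_left, real_inner_self_eq_norm_sq] at h
  have h0 : ‖p - q‖ = 0 := by
    have : ‖p - q‖ ^ 2 = 0 := le_antisymm (by linarith) (sq_nonneg _)
    exact pow_eq_zero_iff (two_ne_zero) |>.1 this
  exact sub_eq_zero.1 (norm_eq_zero.1 h0)

variable [CompleteSpace E]

/-- Direct method without weak topology: the parallelogram identity at midpoints makes a minimizing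
sequence Cauchy, and closed sublevel sets show that its limit attains the infimum. -/
theorem exists_isSubgradient_sub {f : E → EReal} (hf : IsGamma0 f) (x : E) :
    ∃ p, IsSubgradient f p (x - p) := by
  obtain ⟨x₀, hx₀⟩ := hf.proper
  obtain ⟨C, hC, hlb⟩ := hf.exists_lower_bound hx₀
  set J : E → ℝ := fun y => (f y).toReal + ‖y - x‖ ^ 2 / 2 with hJ
  have hbdd : BddBelow (J '' effDom f) := by
    refine ⟨(f x₀).toReal - 1 - C * ‖x - x₀‖ - C ^ 2 / 2, ?_⟩
    rintro _ ⟨y, hy, rfl⟩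
    have h₁ := hlb y hy
    have h₂ : ‖y - x₀‖ ≤ ‖y - x‖ + ‖x - x₀‖ := norm_sub_le_norm_sub_add_norm_sub _ _ _
    have h₃ : C * ‖y - x₀‖ ≤ C * (‖y - x‖ + ‖x - x₀‖) := by gcongr
    simp only [hJ]
    nlinarith [sq_nonneg (‖y - x‖ - C)]
  set m := sInf (J '' effDom f) with hm
  have hne : (J '' effDom f).Nonempty := ⟨_, x₀, hx₀, rfl⟩
  have hmle : ∀ y ∈ effDom f, m ≤ J y := fun y hy => csInf_le hbdd ⟨y, hy, rfl⟩
  have hseq : ∀ n : ℕ, ∃ y ∈ effDom f, J y < m + 1 / ((n : ℝ) + 1) := by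
    intro n
    obtain ⟨_, ⟨y, hy, rfl⟩, hlt⟩ := exists_lt_of_csInf_lt hne
      (lt_add_of_pos_right m (Nat.one_div_pos_of_nat (n := n) (α := ℝ)))
    exact ⟨y, hy, hlt⟩
  choose y hyd hyJ using hseq
  have hmid : ∀ a ∈ effDom f, ∀ b ∈ effDom f, ‖a - b‖ ^ 2 ≤ 4 * (J a + J b - 2 * m) := by
    intro a ha b hb
    obtain ⟨hd, hle⟩ := hf.convex_toReal ha hb (t := 1 / 2) (by norm_num) (by norm_num)
    have h₁ := hmle _ hd
    have hpar : ‖(1 / 2 : ℝ) • a + (1 - 1 / 2 : ℝ) • b - x‖ ^ 2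
        = ‖a - x‖ ^ 2 / 2 + ‖b - x‖ ^ 2 / 2 - ‖a - b‖ ^ 2 / 4 := by
      have e₁ : (1 / 2 : ℝ) • a + (1 - 1 / 2 : ℝ) • b - x = (1 / 2 : ℝ) • ((a - x) + (b - x)) := by
        module
      have e₂ : a - b = (a - x) - (b - x) := by module
      rw [e₁, e₂, norm_smul, mul_pow, norm_add_sq_real, norm_sub_sq_real (a - x) (b - x)]
      norm_num
      ring
    simp only [hJ] at h₁ ⊢
    rw [hpar] at h₁
    linarith
  have hlim : Tendsto (fun n : ℕ => 1 / ((n : ℝ) + 1)) atTop (𝓝 0) :=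
    tendsto_one_div_add_atTop_nhds_zero_nat
  have hcau : CauchySeq y := by
    refine Metric.cauchySeq_iff'.2 fun ε hε => ?_
    obtain ⟨N, hN⟩ :=
      (hlim.eventually (gt_mem_nhds (show (0 : ℝ) < ε ^ 2 / 8 by positivity))).exists
    refine ⟨N, fun n hn => ?_⟩
    have h₁ := hmid _ (hyd n) _ (hyd N)
    have h₂ := hyJ n
    have h₃ := hyJ N
    have h₄ : 1 / ((n : ℝ) + 1) ≤ 1 / ((N : ℝ) + 1) := by gcongr
    rw [dist_eq_norm]
    refine lt_of_pow_lt_pow_left₀ 2 hε.le ?_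
    linarith
  obtain ⟨p, hp⟩ := cauchySeq_tendsto_of_complete hcau
  have hnorm : Tendsto (fun n => ‖y n - x‖ ^ 2 / 2) atTop (𝓝 (‖p - x‖ ^ 2 / 2)) :=
    (((hp.sub_const x).norm).pow 2).div_const 2
  have hkey : ∀ ε > 0, p ∈ effDom f ∧ (f p).toReal ≤ m - ‖p - x‖ ^ 2 / 2 + ε := by
    intro ε hε
    refine (hf.isClosed_sublevel (m - ‖p - x‖ ^ 2 / 2 + ε)).mem_of_tendsto hp ?_
    have h₁ : ∀ᶠ n in atTop, ‖p - x‖ ^ 2 / 2 - ε / 2 < ‖y n - x‖ ^ 2 / 2 :=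
      hnorm.eventually (lt_mem_nhds (by linarith))
    have h₂ : ∀ᶠ n : ℕ in atTop, 1 / ((n : ℝ) + 1) < ε / 2 :=
      hlim.eventually (gt_mem_nhds (by linarith))
    filter_upwards [h₁, h₂] with n hn₁ hn₂
    refine ⟨hyd n, ?_⟩
    have := hyJ n
    simp only [hJ] at this
    linarith
  have hpd := (hkey 1 one_pos).1
  refine ⟨p, isSubgradient_of_isMin hf hpd fun z hz => ?_⟩
  have h₁ : (f p).toReal ≤ m - ‖p - x‖ ^ 2 / 2 :=
    le_of_forall_pos_le_add fun ε hε => (hkey ε hε).2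
  have h₂ := hmle z hz
  simp only [hJ] at h₂
  linarith

theorem isSubgradient_prox {f : E → EReal} (hf : IsGamma0 f) (x : E) :
    IsSubgradient f (prox f x) (x - prox f x) := by
  rw [← mem_argminOn_proxObjective_iff hf]
  have hex : ∃ p, p ∈ argminOn (proxObjective f x) univ := by
    obtain ⟨p, hp⟩ := exists_isSubgradient_sub hf x
    exact ⟨p, (mem_argminOn_proxObjective_iff hf x p).2 hp⟩
  exact Classical.epsilon_spec hex

theorem prox_eq_iff {f : E → EReal} (hf : IsGamma0 f) {x p : E} :
    prox f x = p ↔ IsSubgradient f p (x - p) :=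
  ⟨fun h => h ▸ isSubgradient_prox hf x, fun h => (isSubgradient_prox hf x).eq_of_sub h⟩

theorem argminOn_proxObjective {f : E → EReal} (hf : IsGamma0 f) (x : E) :
    argminOn (proxObjective f x) univ = {prox f x} := by
  ext p
  rw [mem_argminOn_proxObjective_iff hf, ← prox_eq_iff hf, mem_singleton_iff, eq_comm]

/-- Firm nonexpansiveness of the proximity operator. -/
theorem norm_sq_prox_sub_prox_le {f : E → EReal} (hf : IsGamma0 f) (x y : E) :
    ‖prox f x - prox f y‖ ^ 2 ≤ inner ℝ (x - y) (prox f x - prox f y) := by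
  have h := (isSubgradient_prox hf x).inner_sub_nonneg (isSubgradient_prox hf y)
  have e : x - prox f x - (y - prox f y) = (x - y) - (prox f x - prox f y) := by abel
  rw [e, inner_sub_left, real_inner_self_eq_norm_sq] at h
  linarith

end Subgradient

/-! ### Coordinates on the product Hilbert space. -/

section Triple

variable {X K : Type*}

@[simp] theorem xPart_triple (x : X) (y ν : K) : xPart (triple x y ν) = x := rfl

@[simp] theorem yPart_triple (x : X) (y ν : K) : yPart (triple x y ν) = y := rfl

@[simp] theorem nuPart_triple (x : X) (y ν : K) : nuPart (triple x y ν) = ν := rfl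

theorem triple_ext {w w' : Triple X K} (hx : xPart w = xPart w') (hy : yPart w = yPart w')
    (hν : nuPart w = nuPart w') : w = w' := by
  obtain ⟨⟨⟨x, y⟩⟩, ν⟩ := w
  obtain ⟨⟨⟨x', y'⟩⟩, ν'⟩ := w'
  obtain rfl : x = x' := hx
  obtain rfl : y = y' := hy
  obtain rfl : ν = ν' := hν
  rfl

variable [NormedAddCommGroup X] [NormedAddCommGroup K]

@[simp] theorem xPart_add (w w' : Triple X K) : xPart (w + w') = xPart w + xPart w' := rfl

@[simp] theorem yPart_add (w w' : Triple X K) : yPart (w + w') = yPart w + yPart w' := rfl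

@[simp] theorem nuPart_add (w w' : Triple X K) : nuPart (w + w') = nuPart w + nuPart w' := rfl

@[simp] theorem xPart_sub (w w' : Triple X K) : xPart (w - w') = xPart w - xPart w' := rfl

@[simp] theorem yPart_sub (w w' : Triple X K) : yPart (w - w') = yPart w - yPart w' := rfl

@[simp] theorem nuPart_sub (w w' : Triple X K) : nuPart (w - w') = nuPart w - nuPart w' := rfl

theorem norm_sq_triple (w : Triple X K) :
    ‖w‖ ^ 2 = ‖xPart w‖ ^ 2 + ‖yPart w‖ ^ 2 + ‖nuPart w‖ ^ 2 := by
  rw [WithLp.prod_norm_sq_eq_of_L2, WithLp.prod_norm_sq_eq_of_L2]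
  rfl

variable [InnerProductSpace ℝ X] [InnerProductSpace ℝ K]

@[simp] theorem xPart_smul (c : ℝ) (w : Triple X K) : xPart (c • w) = c • xPart w := rfl

@[simp] theorem yPart_smul (c : ℝ) (w : Triple X K) : yPart (c • w) = c • yPart w := rfl

@[simp] theorem nuPart_smul (c : ℝ) (w : Triple X K) : nuPart (c • w) = c • nuPart w := rfl

theorem inner_triple (w w' : Triple X K) :
    inner ℝ w w' = inner ℝ (xPart w) (xPart w') + inner ℝ (yPart w) (yPart w')
      + inner ℝ (nuPart w) (nuPart w') := by
  rw [WithLp.prod_inner_apply, WithLp.prod_inner_apply]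
  rfl

theorem continuous_xPart : Continuous (xPart : Triple X K → X) := by
  have h : (xPart : Triple X K → X)
      = fun w => WithLp.fstL 2 ℝ X K (WithLp.fstL 2 ℝ (WithLp 2 (X × K)) K w) := rfl
  rw [h]
  fun_prop

theorem checkA_fst (A : X →L[ℝ] K) (w : Triple X K) :
    checkA A w.fst = A (xPart w) - yPart w := rfl

theorem sq_mul_norm_sq_le {A : X →L[ℝ] K} {u : ℝ} (hu : 0 < u) (hA : ‖checkA A‖ ≤ 1 / u)
    (x : X) (y : K) : u ^ 2 * ‖A x - y‖ ^ 2 ≤ ‖x‖ ^ 2 + ‖y‖ ^ 2 := by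
  have h₁ : ‖A x - y‖ ≤ 1 / u * ‖(WithLp.toLp 2 (x, y) : WithLp 2 (X × K))‖ :=
    (checkA A).le_of_opNorm_le hA (WithLp.toLp 2 (x, y))
  have h₂ : ‖(WithLp.toLp 2 (x, y) : WithLp 2 (X × K))‖ ^ 2 = ‖x‖ ^ 2 + ‖y‖ ^ 2 := by
    rw [WithLp.prod_norm_sq_eq_of_L2]
    rfl
  rw [← h₂, ← mul_pow]
  refine pow_le_pow_left₀ (by positivity) ?_ 2
  rw [one_div, ← div_eq_inv_mul, le_div_iff₀ hu] at h₁
  linarith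

end Triple

/-! ### Solutions in terms of real values. -/

section SolutionSet

variable {X K : Type*} [NormedAddCommGroup X] [InnerProductSpace ℝ X]
  [NormedAddCommGroup K] [InnerProductSpace ℝ K]
  {f : X → EReal} {g : K → EReal} {A : X →L[ℝ] K}

/-- The qualification condition enters only through `0 ∈ dom g - A (dom f)`: the objective is finite
somewhere, hence finite at every minimizer. -/
theorem mem_solSet_iff (hf : IsGamma0 f) (hg : IsGamma0 g) (hq : Qualified f g A) {x : X} :
    x ∈ solSet f g A ↔ (x ∈ effDom f ∧ A x ∈ effDom g) ∧
      ∀ y ∈ effDom f, A y ∈ effDom g →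
        (f x).toReal + (g (A x)).toReal ≤ (f y).toReal + (g (A y)).toReal := by
  have hco : ∀ y ∈ effDom f, A y ∈ effDom g →
      f y + g (A y) = (((f y).toReal + (g (A y)).toReal : ℝ) : EReal) := by
    intro y hy hy'
    rw [EReal.coe_add, hf.coe_toReal hy, hg.coe_toReal hy']
  have htop : ∀ y, ¬ (y ∈ effDom f ∧ A y ∈ effDom g) → f y + g (A y) = ⊤ := by
    intro y hy
    by_cases h : y ∈ effDom f
    · have : g (A y) = ⊤ := by simpa [effDom, h] using fun h' => hy ⟨h, h'⟩
      rw [this, EReal.add_top_of_ne_bot (hf.ne_bot y)]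
    · have : f y = ⊤ := by simpa [effDom] using h
      rw [this, EReal.top_add_of_ne_bot (hg.ne_bot _)]
  constructor
  · rintro ⟨-, hmin⟩
    have hle : ∀ y, f x + g (A x) ≤ f y + g (A y) := fun y => hmin (mem_univ y)
    have hd : x ∈ effDom f ∧ A x ∈ effDom g := by
      obtain ⟨_, hz, _, ⟨y, hy, rfl⟩, he⟩ := hq.1
      obtain rfl : _ = A y := sub_eq_zero.1 he
      by_contra hcon
      have h := hle y
      rw [htop x hcon, hco y hy hz] at h
      exact absurd (h.trans_lt (EReal.coe_lt_top _)) (lt_irrefl _)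
    refine ⟨hd, fun y hy hy' => ?_⟩
    have h := hle y
    rw [hco x hd.1 hd.2, hco y hy hy'] at h
    exact_mod_cast h
  · rintro ⟨hd, hmin⟩
    refine ⟨mem_univ _, fun y _ => ?_⟩
    change f x + g (A x) ≤ f y + g (A y)
    by_cases hy : y ∈ effDom f ∧ A y ∈ effDom g
    · rw [hco x hd.1 hd.2, hco y hy.1 hy.2]
      exact_mod_cast hmin y hy.1 hy.2
    · rw [htop y hy]
      exact le_top

end SolutionSet

/-! ### The LAL operator: nonexpansiveness, fixed points and KKT conditions. -/

section Operator

variable {X K : Type*} [NormedAddCommGroup X] [InnerProductSpace ℝ X] [CompleteSpace X]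
  [NormedAddCommGroup K] [InnerProductSpace ℝ K] [CompleteSpace K]
  {f : X → EReal} {g : K → EReal} {A : X →L[ℝ] K} {u : ℝ}

/-- With input differences `(a, b, c)` and output differences `p, q` in the first two slots, add
twice the firm nonexpansiveness inequalities `hF`, `hG` to the operator norm bound at `(p - a, q -
b)`. The terms pairing `A a - b` with `A p - q` cancel, and those pairing `c` with `A p - q` match
the expansion of `‖c - u • (A p - q)‖ ^ 2`. -/
theorem lipschitzWith_lalOp (hf : IsGamma0 f) (hg : IsGamma0 g) (hu : 0 < u)
    (hA : ‖checkA A‖ ≤ 1 / u) : LipschitzWith 1 (lalOp f g A u) := by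
  refine LipschitzWith.of_dist_le_mul fun w w' => ?_
  rw [NNReal.coe_one, one_mul, dist_eq_norm, dist_eq_norm]
  refine le_of_sq_le_sq ?_ (norm_nonneg _)
  rw [norm_sq_triple, norm_sq_triple]
  have hF := norm_sq_prox_sub_prox_le hf
    (xPart w - u ^ 2 • (A.adjoint (A (xPart w)) - A.adjoint (yPart w)) + u • A.adjoint (nuPart w))
    (xPart w' - u ^ 2 • (A.adjoint (A (xPart w')) - A.adjoint (yPart w'))
      + u • A.adjoint (nuPart w'))
  have hG := norm_sq_prox_sub_prox_le hg
    (yPart w - u ^ 2 • (-(A (xPart w)) + yPart w) - u • nuPart w)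
    (yPart w' - u ^ 2 • (-(A (xPart w')) + yPart w') - u • nuPart w')
  have hx : xPart (lalOp f g A u w - lalOp f g A u w') = prox f (xPart w
      - u ^ 2 • (A.adjoint (A (xPart w)) - A.adjoint (yPart w)) + u • A.adjoint (nuPart w))
      - prox f (xPart w' - u ^ 2 • (A.adjoint (A (xPart w')) - A.adjoint (yPart w'))
      + u • A.adjoint (nuPart w')) := rfl
  have hy : yPart (lalOp f g A u w - lalOp f g A u w')
      = prox g (yPart w - u ^ 2 • (-(A (xPart w)) + yPart w) - u • nuPart w)
        - prox g (yPart w' - u ^ 2 • (-(A (xPart w')) + yPart w') - u • nuPart w') := rfl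
  have hν : nuPart (lalOp f g A u w - lalOp f g A u w')
      = nuPart (w - w') - u • (A (xPart (lalOp f g A u w - lalOp f g A u w'))
        - yPart (lalOp f g A u w - lalOp f g A u w')) := by
    simp only [xPart_sub, yPart_sub, nuPart_sub, map_sub, smul_sub]
    simp only [lalOp, xPart_triple, yPart_triple, nuPart_triple, smul_sub]
    abel
  rw [← hx] at hF
  rw [← hy] at hG
  rw [hν]
  clear hν hx hy
  generalize xPart (lalOp f g A u w - lalOp f g A u w') = p at *
  generalize yPart (lalOp f g A u w - lalOp f g A u w') = q at *
  have hargF : xPart w - u ^ 2 • (A.adjoint (A (xPart w)) - A.adjoint (yPart w))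
      + u • A.adjoint (nuPart w)
      - (xPart w' - u ^ 2 • (A.adjoint (A (xPart w')) - A.adjoint (yPart w'))
      + u • A.adjoint (nuPart w')) = xPart (w - w')
      - u ^ 2 • A.adjoint (A (xPart (w - w')) - yPart (w - w'))
      + u • A.adjoint (nuPart (w - w')) := by
    simp only [xPart_sub, yPart_sub, nuPart_sub, map_sub]
    module
  have hargG : yPart w - u ^ 2 • (-(A (xPart w)) + yPart w) - u • nuPart w
      - (yPart w' - u ^ 2 • (-(A (xPart w')) + yPart w') - u • nuPart w')
      = yPart (w - w') + u ^ 2 • (A (xPart (w - w')) - yPart (w - w'))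
        - u • nuPart (w - w') := by
    simp only [xPart_sub, yPart_sub, nuPart_sub, map_sub]
    module
  rw [hargF] at hF
  rw [hargG] at hG
  clear hargF hargG
  generalize xPart (w - w') = a at *
  generalize yPart (w - w') = b at *
  generalize nuPart (w - w') = c at *
  rw [inner_add_left, inner_sub_left, real_inner_smul_left, real_inner_smul_left,
    ContinuousLinearMap.adjoint_inner_left, ContinuousLinearMap.adjoint_inner_left] at hF
  rw [inner_sub_left, inner_add_left, real_inner_smul_left, real_inner_smul_left] at hG
  have hN := sq_mul_norm_sq_le hu hA (p - a) (q - b)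
  have e : A (p - a) - (q - b) = (A p - q) - (A a - b) := by rw [map_sub]; abel
  rw [e, norm_sub_sq_real (A p - q), norm_sub_sq_real p a, norm_sub_sq_real q b] at hN
  rw [norm_sub_sq_real, norm_smul, mul_pow, Real.norm_eq_abs, sq_abs, real_inner_smul_right]
  have e₁ : inner ℝ (A p - q) (A a - b) = inner ℝ (A a - b) (A p) - inner ℝ (A a - b) q := by
    rw [real_inner_comm, inner_sub_right]
  have e₂ : inner ℝ c (A p - q) = inner ℝ c (A p) - inner ℝ c q := inner_sub_right _ _ _
  have e₃ : 0 ≤ u ^ 2 * ‖A a - b‖ ^ 2 := by positivity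
  rw [e₁, real_inner_comm a p, real_inner_comm b q] at hN
  rw [e₂]
  linarith

/-- The Karush-Kuhn-Tucker conditions for minimizing `f + g ∘ A`, with scaled multiplier. -/
def IsKKT (f : X → EReal) (g : K → EReal) (A : X →L[ℝ] K) (u : ℝ) (x : X) (ν : K) : Prop :=
  IsSubgradient f x (u • A.adjoint ν) ∧ IsSubgradient g (A x) (-(u • ν))

theorem mem_fixedPoints_lalOp_iff (hf : IsGamma0 f) (hg : IsGamma0 g) (hu : 0 < u)
    (w : Triple X K) : w ∈ Function.fixedPoints (lalOp f g A u) ↔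
      yPart w = A (xPart w) ∧ IsKKT f g A u (xPart w) (nuPart w) := by
  have key : ∀ x y ν, y = A x →
      ((prox f (x - u ^ 2 • (A.adjoint (A x) - A.adjoint y) + u • A.adjoint ν) = x ∧
        prox g (y - u ^ 2 • (-(A x) + y) - u • ν) = y) ↔ IsKKT f g A u x ν) := by
    rintro x y ν rfl
    have e₁ : x - u ^ 2 • (A.adjoint (A x) - A.adjoint (A x)) + u • A.adjoint ν - x
        = u • A.adjoint ν := by module
    have e₂ : A x - u ^ 2 • (-(A x) + A x) - u • ν - A x = -(u • ν) := by module
    rw [prox_eq_iff hf, prox_eq_iff hg, e₁, e₂]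
    rfl
  constructor
  · intro h
    have h : lalOp f g A u w = w := h
    have hx := congrArg xPart h
    have hy := congrArg yPart h
    have hν := congrArg nuPart h
    simp only [lalOp, xPart_triple, yPart_triple, nuPart_triple] at hx hy hν
    rw [hx, hy, sub_eq_self, smul_eq_zero] at hν
    have hyx : yPart w = A (xPart w) := (sub_eq_zero.1 (hν.resolve_left hu.ne')).symm
    exact ⟨hyx, (key _ _ _ hyx).1 ⟨hx, hy⟩⟩
  · rintro ⟨hyx, h⟩
    obtain ⟨hx, hy⟩ := (key _ _ _ hyx).2 h
    refine triple_ext ?_ ?_ ?_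
    · exact hx
    · exact hy
    · simp only [lalOp, nuPart_triple]
      rw [hx, hy, hyx, sub_self, smul_zero, sub_zero]

theorem IsKKT.mem_solSet (hf : IsGamma0 f) (hg : IsGamma0 g) (hq : Qualified f g A) {x : X}
    {ν : K} (h : IsKKT f g A u x ν) : x ∈ solSet f g A := by
  refine (mem_solSet_iff hf hg hq).2 ⟨⟨h.1.1, h.2.1⟩, fun y hy hy' => ?_⟩
  have h₁ := h.1.2 y hy
  have h₂ := h.2.2 _ hy'
  rw [real_inner_smul_left, ContinuousLinearMap.adjoint_inner_left] at h₁
  rw [inner_neg_left, real_inner_smul_left, ← map_sub] at h₂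
  linarith

/-- A multiplier for one solution is a multiplier for all solutions. -/
theorem IsKKT.of_mem_solSet (hf : IsGamma0 f) (hg : IsGamma0 g) (hq : Qualified f g A) {x x' : X}
    {ν : K} (h : IsKKT f g A u x ν) (hx' : x' ∈ solSet f g A) : IsKKT f g A u x' ν := by
  obtain ⟨⟨hd, hd'⟩, hmin⟩ := (mem_solSet_iff hf hg hq).1 hx'
  -- The two subgradient inequalities at `x'` have opposite linear terms, so their sum bounds the
  -- optimal value from above by itself. Both are therefore equalities, which moves the base point
  -- from `x` to `x'`.
  have h₀ := hmin x h.1.1 h.2.1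
  have h₁ := h.1.2 x' hd
  have h₂ := h.2.2 _ hd'
  have key₁ : ∀ y, inner ℝ (u • A.adjoint ν) y = u * inner ℝ ν (A y) := fun y => by
    rw [real_inner_smul_left, ContinuousLinearMap.adjoint_inner_left]
  have key₂ : ∀ z, inner ℝ (-(u • ν)) z = -(u * inner ℝ ν z) := fun z => by
    rw [inner_neg_left, real_inner_smul_left]
  rw [key₁, map_sub, inner_sub_right] at h₁
  rw [key₂, inner_sub_right] at h₂
  refine ⟨⟨hd, fun y hy => ?_⟩, ⟨hd', fun z hz => ?_⟩⟩
  · have h₃ := h.1.2 y hy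
    rw [key₁, map_sub, inner_sub_right] at h₃ ⊢
    linarith
  · have h₃ := h.2.2 z hz
    rw [key₂, inner_sub_right] at h₃ ⊢
    linarith

end Operator

/-! ### A convex open mapping theorem. -/

section ConvexOpenMapping

variable {Z K : Type*} [NormedAddCommGroup Z] [NormedSpace ℝ Z]
  [NormedAddCommGroup K] [NormedSpace ℝ K]

/-- If the image of a bounded closed convex set under a bounded linear map is dense in a ball of
a subspace `V`, then it contains a smaller ball of `V`. -/
theorem mem_image_of_approx [CompleteSpace Z] (L : Z →L[ℝ] K) {D : Set Z} (hconv : Convex ℝ D)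
    (hcl : IsClosed D) {M : ℝ} (hM : ∀ d ∈ D, ‖d‖ ≤ M) (V : Submodule ℝ K)
    (hV : ∀ d ∈ D, L d ∈ V) {r : ℝ} (hr : 0 < r)
    (happ : ∀ k ∈ V, ‖k‖ < r → ∀ ε > 0, ∃ d ∈ D, ‖k - L d‖ < ε)
    {k : K} (hk : k ∈ V) (hkr : ‖k‖ < r / 2) : k ∈ L '' D := by
  have hstep : ∀ e : {e : K // e ∈ V ∧ ‖e‖ < r / 2}, ∃ d ∈ D,
      ‖(2 : ℝ) • (e : K) - L d‖ < r / 2 := by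
    rintro ⟨e, heV, her⟩
    refine happ _ (V.smul_mem 2 heV) ?_ _ (half_pos hr)
    rw [norm_smul, Real.norm_ofNat]
    linarith
  choose pick hpickD hpick using hstep
  -- Residual iteration: double the error and approximate it again. Unrolled, this writes `k` as the
  -- dyadic sum of the `L (d i)` plus `2⁻ⁿ` times a bounded residual.
  let next : {e : K // e ∈ V ∧ ‖e‖ < r / 2} → {e : K // e ∈ V ∧ ‖e‖ < r / 2} := fun e =>
    ⟨(2 : ℝ) • (e : K) - L (pick e), V.sub_mem (V.smul_mem 2 e.2.1) (hV _ (hpickD e)), hpick e⟩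
  let e : ℕ → {e : K // e ∈ V ∧ ‖e‖ < r / 2} := fun n => next^[n] ⟨k, hk, hkr⟩
  have he : ∀ n, (e (n + 1) : K) = (2 : ℝ) • (e n : K) - L (pick (e n)) := by
    intro n
    simp only [e, Function.iterate_succ_apply']
    rfl
  let d : ℕ → Z := fun n => pick (e n)
  have hd : ∀ n, d n ∈ D := fun n => hpickD _
  let s : ℕ → Z := fun n => ∑ i ∈ Finset.range n, (1 / 2 : ℝ) ^ (i + 1) • d i
  have hs : ∀ n, s (n + 1) = s n + (1 / 2 : ℝ) ^ (n + 1) • d n := fun n =>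
    Finset.sum_range_succ _ _
  have hLs : ∀ n, L (s n) = k - (1 / 2 : ℝ) ^ n • (e n : K) := by
    intro n
    induction n with
    | zero => simp [s, e]
    | succ n ih =>
      rw [hs, map_add, ih, he, map_smul]
      simp only [d, pow_succ]
      module
  -- The weights of `s n` add up to `1 - 2⁻ⁿ`, so giving the missing mass to any `q ∈ D` yields a
  -- convex combination.
  have hmem : ∀ n, ∀ q ∈ D, s n + (1 / 2 : ℝ) ^ n • q ∈ D := by
    intro n
    induction n with
    | zero => intro q hq; simpa [s] using hq
    | succ n ih =>
      intro q hq
      have h := ih ((1 / 2 : ℝ) • d n + (1 / 2 : ℝ) • q)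
        (hconv (hd n) hq (by norm_num) (by norm_num) (by norm_num))
      convert h using 1
      rw [hs, pow_succ]
      module
  have hsum : Summable fun i => (1 / 2 : ℝ) ^ (i + 1) • d i := by
    refine Summable.of_norm_bounded (g := fun i => (1 / 2 : ℝ) ^ i * M)
      (summable_geometric_two.mul_right M) fun i => ?_
    rw [norm_smul, norm_pow, Real.norm_of_nonneg (by norm_num : (0 : ℝ) ≤ 1 / 2)]
    have hM0 : 0 ≤ M := (norm_nonneg _).trans (hM _ (hd i))
    calc (1 / 2 : ℝ) ^ (i + 1) * ‖d i‖ ≤ (1 / 2 : ℝ) ^ i * ‖d i‖ := by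
          gcongr ?_ * _
          exact pow_le_pow_of_le_one (by norm_num) (by norm_num) (Nat.le_succ i)
      _ ≤ _ := by gcongr; exact hM _ (hd i)
  have hlim : Tendsto s atTop (𝓝 (∑' i, (1 / 2 : ℝ) ^ (i + 1) • d i)) :=
    hsum.hasSum.tendsto_sum_nat
  have hpow : Tendsto (fun n : ℕ => (1 / 2 : ℝ) ^ n) atTop (𝓝 0) :=
    tendsto_pow_atTop_nhds_zero_of_lt_one (by norm_num) (by norm_num)
  refine ⟨∑' i, (1 / 2 : ℝ) ^ (i + 1) • d i, ?_, ?_⟩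
  · have h : Tendsto (fun n => s n + (1 / 2 : ℝ) ^ n • d 0) atTop
        (𝓝 (∑' i, (1 / 2 : ℝ) ^ (i + 1) • d i)) := by
      simpa using hlim.add (hpow.smul_const (d 0))
    exact hcl.mem_of_tendsto h (Eventually.of_forall fun n => hmem n _ (hd 0))
  · have h₁ := (L.continuous.tendsto _).comp hlim
    have h₂ : Tendsto (fun n => L (s n)) atTop (𝓝 k) := by
      simp only [hLs]
      have : Tendsto (fun n => (1 / 2 : ℝ) ^ n • (e n : K)) atTop (𝓝 0) := by
        refine squeeze_zero_norm (a := fun n => (1 / 2 : ℝ) ^ n * (r / 2)) (fun n => ?_)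
          (by simpa using hpow.mul_const (r / 2))
        rw [norm_smul, norm_pow, Real.norm_of_nonneg (by norm_num : (0 : ℝ) ≤ 1 / 2)]
        gcongr
        exact (e n).2.2.le
      simpa using this.const_sub k
    exact tendsto_nhds_unique h₁ h₂

/-- A convex version of the open mapping theorem. -/
theorem exists_ball_subset_image [CompleteSpace Z] [CompleteSpace K] (L : Z →L[ℝ] K)
    {D : ℕ → Set Z}
    (hmono : Monotone D) (hconv : ∀ n, Convex ℝ (D n)) (hcl : ∀ n, IsClosed (D n))
    (hbd : ∀ n, ∃ M : ℝ, ∀ d ∈ D n, ‖d‖ ≤ M) (V : Submodule ℝ K) (hVcl : IsClosed (V : Set K))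
    (hV : ∀ n, ∀ d ∈ D n, L d ∈ V)
    (habs : ∀ k ∈ V, ∃ t : ℝ, 0 < t ∧ ∃ n, t • k ∈ L '' D n) :
    ∃ N : ℕ, ∃ r : ℝ, 0 < r ∧ ∀ k ∈ V, ‖k‖ ≤ r → k ∈ L '' D N := by
  have himmono : ∀ {m n}, m ≤ n → L '' D m ⊆ L '' D n := fun h => image_mono (hmono h)
  have himconv : ∀ n, Convex ℝ (L '' D n) := fun n => (hconv n).linear_image (L : Z →ₗ[ℝ] K)
  -- Once the origin lies in the image, images can be shrunk towards it; this lets the scale `1 / (n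
  -- + 1)` and the index of `D` be tied together in a countable cover of `V` for Baire's theorem.
  obtain ⟨_, _, n₀, hn₀⟩ := habs 0 V.zero_mem
  rw [smul_zero] at hn₀
  have : CompleteSpace V := hVcl.completeSpace_coe
  let S : ℕ → Set V := fun n => closure {k : V | ((n : ℝ) + 1)⁻¹ • (k : K) ∈ L '' D n}
  have hcover : ⋃ n, S n = univ := by
    refine eq_univ_of_forall fun k => mem_iUnion.2 ?_
    obtain ⟨t, ht, n, hn⟩ := habs k k.2
    obtain ⟨p, hp⟩ := exists_nat_gt t⁻¹
    set m := max (max n n₀) p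
    refine ⟨m, subset_closure ?_⟩
    have hmp : (p : ℝ) ≤ m := by exact_mod_cast le_max_right _ _
    have hsm : ((m : ℝ) + 1)⁻¹ ≤ t := by
      rw [inv_le_comm₀ (by positivity) ht]
      linarith
    have h₁ : t • (k : K) ∈ L '' D m := himmono ((le_max_left _ _).trans (le_max_left _ _)) hn
    have h₂ : (0 : K) ∈ L '' D m := himmono ((le_max_right _ _).trans (le_max_left _ _)) hn₀
    have h₃ := himconv m h₁ h₂ (a := ((m : ℝ) + 1)⁻¹ / t) (b := 1 - ((m : ℝ) + 1)⁻¹ / t)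
      (by positivity) (by rw [sub_nonneg, div_le_one ht]; exact hsm) (by ring)
    rwa [smul_zero, add_zero, smul_smul, div_mul_cancel₀ _ ht.ne'] at h₃
  obtain ⟨n, ⟨k₀, hk₀⟩⟩ := nonempty_interior_of_iUnion_of_closed
    (fun n => (isClosed_closure : IsClosed (S n))) hcover
  obtain ⟨ρ, hρ, hball⟩ := Metric.isOpen_iff.1 isOpen_interior _ hk₀
  set c : ℝ := ((n : ℝ) + 1)⁻¹ with hc
  have hc₀ : 0 < c := by positivity
  have happ : ∀ k ∈ V, ‖k - c • (k₀ : K)‖ < c * ρ → ∀ ε > 0, ∃ d ∈ D n, ‖k - L d‖ < ε := by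
    intro k hk hkr ε hε
    have hin : (⟨c⁻¹ • k, V.smul_mem _ hk⟩ : V) ∈ S n := by
      refine interior_subset (hball ?_)
      rw [Metric.mem_ball, dist_eq_norm]
      change ‖c⁻¹ • k - (k₀ : K)‖ < ρ
      have : c⁻¹ • k - (k₀ : K) = c⁻¹ • (k - c • (k₀ : K)) := by
        rw [smul_sub, smul_smul, inv_mul_cancel₀ hc₀.ne', one_smul]
      rw [this, norm_smul, Real.norm_of_nonneg (by positivity), inv_mul_lt_iff₀ hc₀]
      exact hkr
    obtain ⟨q, ⟨d, hd, hdq⟩, hq⟩ := Metric.mem_closure_iff.1 hin (ε / c) (by positivity)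
    refine ⟨d, hd, ?_⟩
    rw [dist_eq_norm] at hq
    change ‖c⁻¹ • k - (q : K)‖ < ε / c at hq
    have : k - L d = c • (c⁻¹ • k - (q : K)) := by
      rw [hdq, smul_sub, smul_smul, mul_inv_cancel₀ hc₀.ne', one_smul]
    rw [this, norm_smul, Real.norm_of_nonneg hc₀.le]
    rwa [lt_div_iff₀' hc₀] at hq
  obtain ⟨t, ht, n', d', hd', hLd'⟩ := habs (-(c • (k₀ : K))) (V.neg_mem (V.smul_mem _ k₀.2))
  set N := max n n'
  -- Chosen so that `1 - a = a / t`: averaging with `d'`, whose image is `-(t * c) • k₀`, moves the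
  -- centre `c • k₀` of the ball to the origin.
  set a : ℝ := t / (1 + t) with ha
  have ha₀ : 0 < a := by positivity
  have ha₁ : 1 - a = a / t := by rw [ha]; field_simp; ring
  have happ' : ∀ k ∈ V, ‖k‖ < a * (c * ρ) → ∀ ε > 0, ∃ d ∈ D N, ‖k - L d‖ < ε := by
    intro k hk hkr ε hε
    obtain ⟨d, hd, hdk⟩ := happ (c • (k₀ : K) + a⁻¹ • k)
      (V.add_mem (V.smul_mem _ k₀.2) (V.smul_mem _ hk)) (by
        rw [add_sub_cancel_left, norm_smul, Real.norm_of_nonneg (by positivity),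
          inv_mul_lt_iff₀ ha₀]
        exact hkr) (ε / a) (by positivity)
    refine ⟨a • d + (1 - a) • d', hconv N (hmono (le_max_left _ _) hd)
      (hmono (le_max_right _ _) hd') ha₀.le (by rw [ha₁]; positivity) (by ring), ?_⟩
    have : k - L (a • d + (1 - a) • d') = a • (c • (k₀ : K) + a⁻¹ • k - L d) := by
      rw [map_add, map_smul, map_smul, hLd', ha₁, smul_sub, smul_add, smul_smul a a⁻¹,
        mul_inv_cancel₀ ha₀.ne', one_smul, smul_smul (a / t) t, div_mul_cancel₀ _ ht.ne']
      module
    rw [this, norm_smul, Real.norm_of_nonneg ha₀.le]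
    rwa [lt_div_iff₀' ha₀] at hdk
  obtain ⟨M, hM⟩ := hbd N
  refine ⟨N, a * (c * ρ) / 4, by positivity, fun k hk hkr => ?_⟩
  refine mem_image_of_approx L (hconv N) (hcl N) hM V (hV N) (r := a * (c * ρ)) (by positivity)
    happ' hk ?_
  have : 0 < a * (c * ρ) := by positivity
  linarith

end ConvexOpenMapping

/-! ### Existence of multipliers under the qualification condition. -/

section Duality

variable {X K : Type*} [NormedAddCommGroup X] [InnerProductSpace ℝ X] [CompleteSpace X]
  [NormedAddCommGroup K] [InnerProductSpace ℝ K] [CompleteSpace K]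
  {f : X → EReal} {g : K → EReal} {A : X →L[ℝ] K}

/-- Under the qualification condition, the value function of the perturbed problem decreases at
most linearly away from the origin. -/
theorem Qualified.exists_lower_bound (hf : IsGamma0 f) (hg : IsGamma0 g) (hq : Qualified f g A)
    {x : X} (hx : x ∈ solSet f g A) :
    ∃ C : ℝ, ∀ x' ∈ effDom f, ∀ y' ∈ effDom g,
      (f x).toReal + (g (A x)).toReal - C * ‖y' - A x'‖ ≤ (f x').toReal + (g y').toReal := by
  obtain ⟨-, hmin⟩ := (mem_solSet_iff hf hg hq).1 hx
  set m := (f x).toReal + (g (A x)).toReal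
  set S : Set K := effDom g - A '' effDom f with hS
  have hcone : coneHull S = closure (Submodule.span ℝ S : Set K) := by
    simpa only [sub_zero, image_id'] using hq.2
  set V : Submodule ℝ K := (Submodule.span ℝ S).topologicalClosure with hVdef
  have hSV : ∀ x' ∈ effDom f, ∀ y' ∈ effDom g, y' - A x' ∈ V := fun x' hx' y' hy' =>
    Submodule.le_topologicalClosure _ (Submodule.subset_span ⟨y', hy', _, ⟨x', hx', rfl⟩, rfl⟩)
  let L : X × K →L[ℝ] K := ContinuousLinearMap.snd ℝ X K - A ∘L ContinuousLinearMap.fst ℝ X K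
  have hL : ∀ z, L z = z.2 - A z.1 := fun z => rfl
  -- Bounded closed convex pieces on which both functions are at most `n`. A ball covered by the
  -- image of one piece therefore comes with the uniform bound `2 * N` on the objective.
  let D : ℕ → Set (X × K) := fun n => Metric.closedBall 0 n ∩
    ({a | a ∈ effDom f ∧ (f a).toReal ≤ n} ×ˢ {b | b ∈ effDom g ∧ (g b).toReal ≤ n})
  obtain ⟨N, r, hr, hN⟩ := exists_ball_subset_image L (D := D)
    (by
      rintro n n' hn z ⟨hz, ⟨hz₁, hz₁'⟩, hz₂, hz₂'⟩
      have hn : (n : ℝ) ≤ n' := by exact_mod_cast hn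
      exact ⟨Metric.closedBall_subset_closedBall hn hz, ⟨hz₁, hz₁'.trans hn⟩, hz₂,
        hz₂'.trans hn⟩)
    (fun n => (convex_closedBall _ _).inter ((hf.convex_sublevel n).prod (hg.convex_sublevel n)))
    (fun n => Metric.isClosed_closedBall.inter
      ((hf.isClosed_sublevel n).prod (hg.isClosed_sublevel n)))
    (fun n => ⟨n, fun d hd => by simpa using hd.1⟩)
    V (Submodule.isClosed_topologicalClosure _)
    (fun n d hd => hSV _ hd.2.1.1 _ hd.2.2.1)
    (by
      intro k hk
      have hk' : k ∈ coneHull S := by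
        rw [hcone]
        exact hk
      obtain ⟨t, ht, _, ⟨y', hy', _, ⟨x', hx', rfl⟩, rfl⟩, rfl⟩ := hk'
      refine ⟨t⁻¹, by positivity, ?_⟩
      obtain ⟨n, hn⟩ := exists_nat_ge (max ‖(x', y')‖ (max (f x').toReal (g y').toReal))
      refine ⟨n, (x', y'), ⟨?_, ⟨hx', ?_⟩, hy', ?_⟩, ?_⟩
      · simpa using (le_max_left _ _).trans hn
      · exact (le_max_left _ _).trans ((le_max_right _ _).trans hn)
      · exact (le_max_right _ _).trans ((le_max_right _ _).trans hn)
      · rw [hL, smul_smul, inv_mul_cancel₀ ht.ne', one_smul])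
  refine ⟨(2 * N - m) / r, fun x' hx' y' hy' => ?_⟩
  set k := y' - A x' with hk
  set t : ℝ := ‖k‖ / r with ht
  have ht₀ : 0 ≤ t := by positivity
  -- A point opposite to `k` on the sphere of radius `r`; for `k = 0`, division by zero makes it the
  -- origin.
  have hc : ‖(-(r / ‖k‖)) • k‖ ≤ r := by
    rw [norm_smul, norm_neg, Real.norm_of_nonneg (by positivity)]
    rcases eq_or_ne ‖k‖ 0 with h0 | h0
    · rw [h0, mul_zero]; exact hr.le
    · rw [div_mul_cancel₀ _ h0]
  obtain ⟨⟨a, b⟩, ⟨-, ⟨ha, haN⟩, hb, hbN⟩, hab⟩ := hN _ (V.smul_mem _ (hSV x' hx' y' hy')) hc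
  rw [hL] at hab
  simp only at ha haN hb hbN hab
  -- With this weight the perturbations `k` and `-(r / ‖k‖) • k` average to zero, so the averaged
  -- pair is feasible for the unperturbed problem and its value is at least `m`.
  set s : ℝ := 1 / (1 + t) with hs
  have hs₀ : 0 < s := by positivity
  have hs₁ : s ≤ 1 := by rw [hs, div_le_one (by positivity)]; linarith
  have hst : 1 - s = t * s := by rw [hs]; field_simp; ring
  obtain ⟨h₁, h₁'⟩ := hf.convex_toReal hx' ha hs₀.le hs₁
  obtain ⟨h₂, h₂'⟩ := hg.convex_toReal hy' hb hs₀.le hs₁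
  have hzero : A (s • x' + (1 - s) • a) = s • y' + (1 - s) • b := by
    have e : s • y' + (1 - s) • b - A (s • x' + (1 - s) • a) = 0 := by
      have : s • y' + (1 - s) • b - A (s • x' + (1 - s) • a) = s • k + (1 - s) • (b - A a) := by
        rw [map_add, map_smul, map_smul, hk]
        module
      rw [this, hab, hst, smul_smul, ← add_smul]
      rcases eq_or_ne ‖k‖ 0 with h0 | h0
      · rw [norm_eq_zero.1 h0, smul_zero]
      · have : s + t * s * -(r / ‖k‖) = 0 := by
          rw [ht]; field_simp; ring
        rw [this, zero_smul]
    exact (sub_eq_zero.1 e).symm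
  have h₃ := hmin _ h₁ (by rw [hzero]; exact h₂)
  rw [hzero] at h₃
  have h₄ : (2 * N - m) / r * ‖k‖ = t * (2 * N - m) := by rw [ht]; ring
  rw [h₄]
  have h₅ : (1 - s) * (f a).toReal + (1 - s) * (g b).toReal ≤ (1 - s) * (2 * N) := by
    have : 0 ≤ 1 - s := by linarith
    nlinarith
  have h₆ : s * (m - t * (2 * N - m)) ≤ s * ((f x').toReal + (g y').toReal) := by
    have e₁ : s * (m - t * (2 * N - m)) = m - (1 - s) * (2 * N) := by
      have : s * (1 + t) = 1 := by rw [hs]; field_simp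
      rw [hst]
      linear_combination m * this
    rw [e₁]
    linarith
  exact le_of_mul_le_mul_left h₆ hs₀

/-- The vector `ν` is a subgradient at `0` of the value function of the perturbation `y' - A x'`.
The linear lower bound provides an open convex cone `O` disjoint from the convex set `P` above the
value function; a separating functional, divided by its vertical component, gives `ν`. -/
theorem Qualified.exists_multiplier (hf : IsGamma0 f) (hg : IsGamma0 g) (hq : Qualified f g A)
    {x : X} (hx : x ∈ solSet f g A) :
    ∃ ν : K, ∀ x' ∈ effDom f, ∀ y' ∈ effDom g,
      (f x).toReal + (g (A x)).toReal + inner ℝ ν (y' - A x')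
        ≤ (f x').toReal + (g y').toReal := by
  obtain ⟨C, hC⟩ := hq.exists_lower_bound hf hg hx
  obtain ⟨⟨hxf, hxg⟩, -⟩ := (mem_solSet_iff hf hg hq).1 hx
  set m := (f x).toReal + (g (A x)).toReal with hm
  -- The absolute value makes the bound a concave function of the perturbation, so that `O` is
  -- convex.
  have hC' : ∀ x' ∈ effDom f, ∀ y' ∈ effDom g,
      m - |C| * ‖y' - A x'‖ ≤ (f x').toReal + (g y').toReal := fun x' hx' y' hy' => by
    have h := hC x' hx' y' hy'
    have : C * ‖y' - A x'‖ ≤ |C| * ‖y' - A x'‖ := by gcongr; exact le_abs_self C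
    linarith
  let O : Set (K × ℝ) := {q | q.2 < m - |C| * ‖q.1‖}
  let P : Set (K × ℝ) := {q | ∃ x' ∈ effDom f, ∃ y' ∈ effDom g, q.1 = y' - A x' ∧
    (f x').toReal + (g y').toReal ≤ q.2}
  have hOopen : IsOpen O := isOpen_lt (by fun_prop) (by fun_prop)
  have hOconv : Convex ℝ O := by
    rintro ⟨k, s⟩ hk ⟨k', s'⟩ hk' a b ha hb hab
    simp only [O, mem_ofPred_eq, Prod.smul_mk, Prod.mk_add_mk, smul_eq_mul] at hk hk' ⊢
    have h₁ : ‖a • k + b • k'‖ ≤ a * ‖k‖ + b * ‖k'‖ := by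
      refine (norm_add_le _ _).trans ?_
      rw [norm_smul, norm_smul, Real.norm_of_nonneg ha, Real.norm_of_nonneg hb]
    have h₂ : |C| * ‖a • k + b • k'‖ ≤ |C| * (a * ‖k‖ + b * ‖k'‖) := by gcongr
    obtain rfl : b = 1 - a := by linarith
    rcases ha.eq_or_lt with rfl | ha'
    · simp at h₂ ⊢; linarith
    · have h₃ : a * s < a * (m - |C| * ‖k‖) := by gcongr
      have h₄ : (1 - a) * s' ≤ (1 - a) * (m - |C| * ‖k'‖) := by gcongr
      nlinarith
  have hPconv : Convex ℝ P := by
    rintro ⟨k, s⟩ ⟨x₁, hx₁, y₁, hy₁, hk, hs⟩ ⟨k', s'⟩ ⟨x₂, hx₂, y₂, hy₂, hk', hs'⟩ a b ha hb hab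
    obtain rfl : b = 1 - a := by linarith
    obtain ⟨h₁, h₁'⟩ := hf.convex_toReal hx₁ hx₂ ha (by linarith)
    obtain ⟨h₂, h₂'⟩ := hg.convex_toReal hy₁ hy₂ ha (by linarith)
    refine ⟨_, h₁, _, h₂, ?_, ?_⟩
    · simp only at hk hk'
      simp only [Prod.smul_mk, Prod.mk_add_mk, hk, hk', map_add, map_smul]
      module
    · simp only [Prod.smul_mk, Prod.mk_add_mk, smul_eq_mul] at hs hs' ⊢
      nlinarith
  have hdisj : Disjoint O P := by
    rw [Set.disjoint_left]
    rintro ⟨k, s⟩ hO ⟨x', hx', y', hy', hk, hs⟩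
    simp only [O, mem_ofPred_eq] at hO hk hs
    have := hC' x' hx' y' hy'
    rw [hk] at hO
    linarith
  obtain ⟨φ, c, hφO, hφP⟩ := geometric_hahn_banach_open hOconv hOopen hPconv hdisj
  set β := φ (0, 1) with hβ
  have hsplit : ∀ (k : K) (s : ℝ), φ (k, s) = φ (k, 0) + s * β := by
    intro k s
    have : ((k, s) : K × ℝ) = (k, 0) + s • (0, 1) := by simp
    rw [this, map_add, map_smul, smul_eq_mul]
  have hφ0 : φ ((0 : K), (0 : ℝ)) = 0 := map_zero φ
  have hPm : ((0 : K), m) ∈ P := ⟨x, hxf, A x, hxg, (sub_self _).symm, le_rfl⟩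
  have hOs : ∀ s < m, s * β < c := by
    intro s hs
    have h := hφO (0, s) (by simpa [O] using hs)
    rwa [hsplit, hφ0, zero_add] at h
  have hPm' : c ≤ m * β := by
    have h := hφP _ hPm
    rwa [hsplit, hφ0, zero_add] at h
  -- The separation is not vertical: `(0, m)` lies in `P`, while `(0, s)` lies in `O` for every `s <
  -- m`.
  have hβpos : 0 < β := by
    have := hOs (m - 1) (by linarith)
    linarith
  have hcm : m * β ≤ c := by
    refine le_of_forall_pos_lt_add fun ε hε => ?_
    have h := hOs (m - ε / β) (by have : 0 < ε / β := by positivity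
                                  linarith)
    rw [sub_mul, div_mul_cancel₀ _ hβpos.ne'] at h
    linarith
  let ψ : K →L[ℝ] ℝ := φ ∘L ContinuousLinearMap.inl ℝ K ℝ
  refine ⟨-(β⁻¹ • (InnerProductSpace.toDual ℝ K).symm ψ), fun x' hx' y' hy' => ?_⟩
  have h := hφP (y' - A x', (f x').toReal + (g y').toReal) ⟨x', hx', y', hy', rfl, le_rfl⟩
  rw [hsplit] at h
  have hψ : ψ (y' - A x') = φ (y' - A x', 0) := rfl
  rw [inner_neg_left, real_inner_smul_left, InnerProductSpace.toDual_symm_apply, hψ]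
  have h₁ : β * (m + -(β⁻¹ * φ (y' - A x', 0))) ≤ β * ((f x').toReal + (g y').toReal) := by
    rw [mul_add, mul_neg, ← mul_assoc, mul_inv_cancel₀ hβpos.ne', one_mul]
    linarith
  exact le_of_mul_le_mul_left h₁ hβpos

/-- The joint inequality decouples: `y' = A x` leaves the condition on `f`, and `x' = x` leaves the
one on `g`. The factor `-u⁻¹` matches the scaling and sign in `IsKKT`. -/
theorem Qualified.exists_isKKT (hf : IsGamma0 f) (hg : IsGamma0 g) (hq : Qualified f g A)
    {u : ℝ} (hu : 0 < u) {x : X} (hx : x ∈ solSet f g A) : ∃ ν, IsKKT f g A u x ν := by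
  obtain ⟨ν, hν⟩ := hq.exists_multiplier hf hg hx
  obtain ⟨⟨hxf, hxg⟩, -⟩ := (mem_solSet_iff hf hg hq).1 hx
  refine ⟨-(u⁻¹ • ν), ⟨hxf, fun y hy => ?_⟩, ⟨hxg, fun z hz => ?_⟩⟩
  · have h := hν y hy _ hxg
    rw [real_inner_smul_left, ContinuousLinearMap.adjoint_inner_left, inner_neg_left,
      real_inner_smul_left, mul_neg, ← mul_assoc, mul_inv_cancel₀ hu.ne', one_mul, map_sub,
      ← inner_neg_right, neg_sub]
    linarith
  · have h := hν x hxf z hz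
    rw [smul_neg, neg_neg, smul_smul, mul_inv_cancel₀ hu.ne', one_smul]
    linarith

/-- The solution set is the projection of the fixed point set of the LAL operator. -/
theorem solSet_eq_image_fixedPoints (hf : IsGamma0 f) (hg : IsGamma0 g) (hq : Qualified f g A)
    {u : ℝ} (hu : 0 < u) :
    solSet f g A = xPart '' Function.fixedPoints (lalOp f g A u) := by
  ext x
  constructor
  · intro hx
    obtain ⟨ν, hν⟩ := hq.exists_isKKT hf hg hu hx
    exact ⟨triple x (A x) ν, (mem_fixedPoints_lalOp_iff hf hg hu _).2 ⟨rfl, hν⟩, rfl⟩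
  · rintro ⟨w, hw, rfl⟩
    exact ((mem_fixedPoints_lalOp_iff hf hg hu _).1 hw).2.mem_solSet hf hg hq

end Duality

/-! ### Perturbed contraction recursions for real sequences. -/

section RealSequences

theorem tendsto_sum_range_shift {l : ℕ → ℝ}
    (h : Tendsto (fun n => ∑ i ∈ Finset.range n, l i) atTop atTop) (N : ℕ) :
    Tendsto (fun n => ∑ i ∈ Finset.range n, l (N + i)) atTop atTop := by
  have h₁ : ∀ n, ∑ i ∈ Finset.range n, l (N + i)
      = -(∑ i ∈ Finset.range N, l i) + ∑ i ∈ Finset.range (n + N), l i := by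
    intro n
    rw [add_comm n N, Finset.sum_range_add]
    ring
  simp only [h₁]
  exact tendsto_atTop_add_const_left _ _ (h.comp (tendsto_add_atTop_nat N))

theorem tendsto_prod_one_sub_zero {γ : ℕ → ℝ} (hγ₁ : ∀ n, γ n ≤ 1)
    (hγ : Tendsto (fun n => ∑ i ∈ Finset.range n, γ i) atTop atTop) :
    Tendsto (fun n => ∏ i ∈ Finset.range n, (1 - γ i)) atTop (𝓝 0) := by
  refine squeeze_zero (fun n => Finset.prod_nonneg fun i _ => sub_nonneg.2 (hγ₁ i)) (fun n => ?_)
    (Real.tendsto_exp_neg_atTop_nhds_zero.comp hγ)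
  calc ∏ i ∈ Finset.range n, (1 - γ i) ≤ ∏ i ∈ Finset.range n, Real.exp (-γ i) :=
        Finset.prod_le_prod (fun i _ => sub_nonneg.2 (hγ₁ i))
          fun i _ => Real.one_sub_le_exp_neg _
    _ = _ := by rw [← Real.exp_sum, Finset.sum_neg_distrib]; rfl

/-- Convergence to zero of sequences satisfying a perturbed contraction inequality. -/
theorem tendsto_zero_of_le_one_sub_mul_add {a γ δ β : ℕ → ℝ} (ha : ∀ n, 0 ≤ a n)
    (hγ₀ : ∀ n, 0 ≤ γ n) (hγ₁ : ∀ n, γ n ≤ 1)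
    (hγ : Tendsto (fun n => ∑ i ∈ Finset.range n, γ i) atTop atTop)
    (hδ : ∀ ε > 0, ∀ᶠ n in atTop, δ n ≤ ε) (hβ₀ : ∀ n, 0 ≤ β n) (hβ : Summable β)
    (hrec : ∀ n, a (n + 1) ≤ (1 - γ n) * a n + γ n * δ n + β n) :
    Tendsto a atTop (𝓝 0) := by
  have key : ∀ ε > 0, ∀ᶠ n in atTop, a n < ε := by
    intro ε' hε'
    obtain ⟨ε, hε, rfl⟩ : ∃ ε > 0, ε' = 4 * ε := ⟨ε' / 4, by linarith, by ring⟩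
    have htail : ∀ᶠ N in atTop, ∑' k, β (k + N) < ε :=
      (tendsto_sum_nat_add β).eventually (gt_mem_nhds hε)
    obtain ⟨N, hN₁, hN₂⟩ := ((eventually_forall_ge_atTop.2 (hδ ε hε)).and htail).exists
    have hsumβ : ∀ k, ∑ i ∈ Finset.range k, β (N + i) ≤ ε := by
      intro k
      have hs : Summable fun i => β (i + N) := (summable_nat_add_iff N).2 hβ
      have := hs.sum_le_tsum (Finset.range k) fun i _ => hβ₀ _
      simp only [add_comm N]
      linarith
    have hind : ∀ k, a (N + k) ≤ ε + (∏ i ∈ Finset.range k, (1 - γ (N + i))) * a N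
        + ∑ i ∈ Finset.range k, β (N + i) := by
      intro k
      induction k with
      | zero => simp [hε.le]
      | succ k ih =>
        rw [Finset.prod_range_succ, Finset.sum_range_succ]
        have h₁ := hrec (N + k)
        have h₂ : γ (N + k) * δ (N + k) ≤ γ (N + k) * ε :=
          mul_le_mul_of_nonneg_left (hN₁ _ (Nat.le_add_right N k)) (hγ₀ _)
        have h₃ := mul_le_mul_of_nonneg_left ih (sub_nonneg.2 (hγ₁ (N + k)))
        have h₄ : 0 ≤ γ (N + k) * ∑ i ∈ Finset.range k, β (N + i) :=
          mul_nonneg (hγ₀ _) (Finset.sum_nonneg fun i _ => hβ₀ _)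
        rw [← add_assoc N k 1]
        nlinarith
    have hprod : Tendsto (fun k => (∏ i ∈ Finset.range k, (1 - γ (N + i))) * a N) atTop (𝓝 0) := by
      simpa using (tendsto_prod_one_sub_zero (fun n => hγ₁ (N + n))
        (tendsto_sum_range_shift hγ N)).mul_const (a N)
    obtain ⟨k₀, hk₀⟩ := eventually_atTop.1 (hprod.eventually (gt_mem_nhds hε))
    filter_upwards [eventually_ge_atTop (N + k₀)] with n hn
    obtain ⟨k, rfl⟩ : ∃ k, n = N + k := ⟨n - N, by omega⟩
    have h₁ := hind k
    have h₂ := hk₀ k (by omega)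
    have h₃ := hsumβ k
    linarith
  refine tendsto_order.2 ⟨fun b hb => Eventually.of_forall fun n => hb.trans_le (ha n), key⟩

end RealSequences

/-! ### Nonexpansive maps and convergence of hybrid steepest descent. -/

section Nonexpansive

theorem norm_sub_le_of_nonexpansive {H : Type*} [SeminormedAddCommGroup H] {T : H → H}
    (hT : LipschitzWith 1 T) (a b : H) : ‖T a - T b‖ ≤ ‖a - b‖ := by
  simpa [dist_eq_norm] using hT.dist_le_mul a b

variable {H : Type*} [NormedAddCommGroup H] [InnerProductSpace ℝ H] {T : H → H}

/-- The displacement mapping of a nonexpansive mapping is monotone. -/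
theorem inner_displacement_nonneg (hT : LipschitzWith 1 T) (a b : H) :
    0 ≤ inner ℝ ((a - T a) - (b - T b)) (a - b) := by
  have e : (a - T a) - (b - T b) = (a - b) - (T a - T b) := by abel
  rw [e, inner_sub_left, real_inner_self_eq_norm_sq]
  have h₁ := real_inner_le_norm (T a - T b) (a - b)
  have h₂ : ‖T a - T b‖ * ‖a - b‖ ≤ ‖a - b‖ * ‖a - b‖ := by
    gcongr
    exact norm_sub_le_of_nonexpansive hT a b
  nlinarith

/-- The equation says that `z` is fixed by `z ↦ (s • v + T z) / (1 + s)`, a contraction with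
constant `1 / (1 + s)`. -/
theorem exists_regularized_fixedPoint [CompleteSpace H] (hT : LipschitzWith 1 T) (v : H) {s : ℝ}
    (hs : 0 < s) : ∃ z, z - T z = s • (v - z) := by
  let Φ : H → H := fun z => (1 + s)⁻¹ • (s • v + T z)
  have hlt : (1 + s)⁻¹ < 1 := inv_lt_one_of_one_lt₀ (by linarith)
  have hΦ : ContractingWith (⟨(1 + s)⁻¹, by positivity⟩ : ℝ≥0) Φ := by
    refine ⟨by exact_mod_cast hlt, LipschitzWith.of_dist_le_mul fun a b => ?_⟩
    rw [dist_eq_norm, dist_eq_norm]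
    have e : Φ a - Φ b = (1 + s)⁻¹ • (T a - T b) := by simp only [Φ]; module
    rw [e, norm_smul, Real.norm_of_nonneg (by positivity)]
    exact mul_le_mul_of_nonneg_left (norm_sub_le_of_nonexpansive hT a b) (by positivity)
  refine ⟨hΦ.fixedPoint, ?_⟩
  have h : Φ hΦ.fixedPoint = hΦ.fixedPoint := hΦ.fixedPoint_isFixedPt
  generalize hΦ.fixedPoint = z at h ⊢
  have h₁ : (1 + s) • z = s • v + T z := by
    conv_lhs => rw [← h]
    simp only [Φ]
    rw [smul_smul, mul_inv_cancel₀ (by positivity), one_smul]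
  have h₂ : T z = (1 + s) • z - s • v := by rw [h₁]; abel
  rw [h₂]
  module

/-- The regularized fixed points `z = T z + s • (v - z)` converge, as `s → 0`, to the point of
`Fix T` that is closest to `v`. -/
theorem exists_tendsto_regularized_fixedPoint [CompleteSpace H] (hT : LipschitzWith 1 T)
    (hne : (Function.fixedPoints T).Nonempty) (v : H) :
    ∃ (s : ℕ → ℝ) (z : ℕ → H) (p : H), (∀ n, 0 < s n) ∧
      (∀ n, z n - T (z n) = s n • (v - z n)) ∧ Tendsto z atTop (𝓝 p) ∧
      p ∈ Function.fixedPoints T ∧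
      ∀ q ∈ Function.fixedPoints T, inner ℝ (v - p) (q - p) ≤ 0 := by
  let s : ℕ → ℝ := fun n => 1 / ((n : ℝ) + 1)
  have hs : ∀ n, 0 < s n := fun n => Nat.one_div_pos_of_nat
  have hslim : Tendsto s atTop (𝓝 0) := tendsto_one_div_add_atTop_nhds_zero_nat
  choose z hz using fun n => exists_regularized_fixedPoint hT v (hs n)
  have hfix : ∀ q ∈ Function.fixedPoints T, ∀ n, inner ℝ (v - z n) (q - z n) ≤ 0 := by
    intro q hq n
    have hq : T q = q := hq
    have h := inner_displacement_nonneg hT (z n) q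
    rw [hq, sub_self, sub_zero, hz, real_inner_smul_left, ← neg_sub q, inner_neg_right] at h
    by_contra! hcon
    nlinarith [mul_pos (hs n) hcon]
  -- Monotonicity of the displacement along the path. The numbers `‖v - z n‖ ^ 2` increase and are
  -- bounded, and their increments dominate `‖z n - z m‖ ^ 2`, so `z` is Cauchy.
  have hmono : ∀ m n, m ≤ n →
      ‖v - z m‖ ^ 2 + ‖z n - z m‖ ^ 2 ≤ ‖v - z n‖ ^ 2 := by
    intro m n hmn
    rcases hmn.eq_or_lt with rfl | hmn
    · simp
    have hlt : s n < s m := by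
      simp only [s]
      gcongr
    have h := inner_displacement_nonneg hT (z m) (z n)
    rw [hz, hz] at h
    have e : z m - z n = (v - z n) - (v - z m) := by abel
    have e' : z n - z m = (v - z m) - (v - z n) := by abel
    rw [e] at h
    rw [e']
    generalize v - z m = a at *
    generalize v - z n = b at *
    have h₁ : inner ℝ (s m • a - s n • b) (b - a)
        = (s m + s n) * inner ℝ a b - s m * ‖a‖ ^ 2 - s n * ‖b‖ ^ 2 := by
      rw [inner_sub_left, inner_sub_right, inner_sub_right, real_inner_smul_left,
        real_inner_smul_left, real_inner_smul_left, real_inner_smul_left,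
        real_inner_self_eq_norm_sq, real_inner_self_eq_norm_sq, real_inner_comm a b]
      ring
    rw [h₁] at h
    have h₂ := norm_sub_sq_real a b
    have h₃ : (s m + s n) * ‖a - b‖ ^ 2 ≤ (s m - s n) * (‖b‖ ^ 2 - ‖a‖ ^ 2) := by
      rw [h₂]
      linarith
    have h₄ : (s m - s n) * ‖a - b‖ ^ 2 ≤ (s m + s n) * ‖a - b‖ ^ 2 := by
      have := hs n
      gcongr
      linarith
    have h₅ := le_of_mul_le_mul_left (h₄.trans h₃) (sub_pos.2 hlt)
    linarith
  obtain ⟨q₀, hq₀⟩ := hne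
  have hbdd : ∀ n, ‖v - z n‖ ^ 2 ≤ ‖v - q₀‖ ^ 2 := by
    intro n
    have h := hfix q₀ hq₀ n
    have e : v - q₀ = (v - z n) - (q₀ - z n) := by abel
    rw [e, norm_sub_sq_real (v - z n)]
    nlinarith [sq_nonneg ‖q₀ - z n‖]
  have hcau : CauchySeq z := by
    have hm : Monotone fun n => ‖v - z n‖ ^ 2 := fun m n hmn => by
      have := hmono m n hmn
      have := sq_nonneg ‖z n - z m‖
      simp only
      linarith
    have hc := (tendsto_atTop_ciSup hm ⟨_, by rintro _ ⟨n, rfl⟩; exact hbdd n⟩).cauchySeq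
    refine Metric.cauchySeq_iff'.2 fun ε hε => ?_
    obtain ⟨N, hN⟩ := Metric.cauchySeq_iff'.1 hc (ε ^ 2) (by positivity)
    refine ⟨N, fun n hn => ?_⟩
    have h₁ := hN n hn
    rw [Real.dist_eq] at h₁
    have h₂ := hmono N n hn
    have h₃ := le_abs_self (‖v - z n‖ ^ 2 - ‖v - z N‖ ^ 2)
    rw [dist_eq_norm]
    refine lt_of_pow_lt_pow_left₀ 2 hε.le ?_
    linarith
  obtain ⟨p, hp⟩ := cauchySeq_tendsto_of_complete hcau
  refine ⟨s, z, p, hs, hz, hp, ?_, fun q hq => ?_⟩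
  · have h₁ : Tendsto (fun n => z n - T (z n)) atTop (𝓝 (p - T p)) :=
      hp.sub ((hT.continuous.tendsto p).comp hp)
    have h₂ : Tendsto (fun n => z n - T (z n)) atTop (𝓝 0) := by
      simp only [hz]
      simpa using hslim.smul (hp.const_sub v)
    exact (sub_eq_zero.1 (tendsto_nhds_unique h₁ h₂)).symm
  · exact le_of_tendsto ((hp.const_sub v).inner (hp.const_sub q))
      (Eventually.of_forall fun n => hfix q hq n)

/-- If `p` is the point of `Fix T` closest to `v`, then bounded sequences of approximate fixed
points asymptotically lie in the half-space supporting `Fix T` at `p`. -/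
theorem eventually_inner_le_of_approx_fixedPoint [CompleteSpace H] (hT : LipschitzWith 1 T)
    {v p : H} (hp : p ∈ Function.fixedPoints T)
    (hvp : ∀ q ∈ Function.fixedPoints T, inner ℝ (v - p) (q - p) ≤ 0)
    {w : ℕ → H} {M : ℝ} (hM : ∀ n, ‖w n - p‖ ≤ M)
    (hw : Tendsto (fun n => w n - T (w n)) atTop (𝓝 0)) {ε : ℝ} (hε : 0 < ε) :
    ∀ᶠ n in atTop, inner ℝ (v - p) (w n - p) ≤ ε := by
  obtain ⟨s, z, p', hs, hz, hzp, hp', hvp'⟩ := exists_tendsto_regularized_fixedPoint hT ⟨p, hp⟩ v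
  -- The variational characterization of the closest point determines it uniquely.
  obtain rfl : p = p' := by
    have h₁ := hvp p' hp'
    have h₂ := hvp' p hp
    have h₃ : inner ℝ (p - p') (p - p') ≤ 0 := by
      have e : p - p' = (v - p') - (v - p) := by abel
      have e₁ : inner ℝ (p - p') (p - p')
          = inner ℝ (v - p') (p - p') + inner ℝ (v - p) (p' - p) := by
        conv_lhs => rw [show inner ℝ (p - p') (p - p')
          = inner ℝ ((v - p') - (v - p)) (p - p') by rw [← e]]
        rw [inner_sub_left, ← neg_sub p' p, inner_neg_right, inner_neg_right]
        ring
      linarith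
    rw [real_inner_self_eq_norm_sq] at h₃
    exact sub_eq_zero.1 (norm_eq_zero.1 (pow_eq_zero_iff two_ne_zero |>.1
      (le_antisymm h₃ (sq_nonneg _))))
  have hM₀ : 0 ≤ M := (norm_nonneg _).trans (hM 0)
  -- error made by replacing `p` with a regularized fixed point
  have hzero : Tendsto (fun k => ‖z k - p‖ * M + ‖v - z k‖ * ‖z k - p‖) atTop (𝓝 0) := by
    have h₁ : Tendsto (fun k => ‖z k - p‖) atTop (𝓝 0) := by
      simpa using (hzp.sub_const p).norm
    simpa using (h₁.mul_const M).add (((hzp.const_sub v).norm).mul h₁)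
  obtain ⟨k, hk⟩ := (hzero.eventually (gt_mem_nhds (half_pos hε))).exists
  have hsmall : Tendsto (fun n => ‖w n - T (w n)‖ * (M + ‖z k - p‖)) atTop (𝓝 0) := by
    simpa using hw.norm.mul_const (M + ‖z k - p‖)
  filter_upwards [hsmall.eventually (gt_mem_nhds (show 0 < s k * (ε / 2) from
    mul_pos (hs k) (half_pos hε)))] with n hn
  -- With `k` fixed, monotonicity of the displacement between `z k` and `w n` bounds the inner
  -- product by the vanishing residual of `w n`.
  have h₁ : s k * inner ℝ (v - z k) (w n - z k) ≤ s k * (ε / 2) := by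
    have h := inner_displacement_nonneg hT (z k) (w n)
    rw [hz, inner_sub_left, real_inner_smul_left, ← neg_sub (w n) (z k), inner_neg_right,
      inner_neg_right] at h
    have h₂ := real_inner_le_norm (w n - T (w n)) (w n - z k)
    have h₃ : ‖w n - z k‖ ≤ M + ‖z k - p‖ := by
      have e : w n - z k = (w n - p) - (z k - p) := by abel
      rw [e]
      exact (norm_sub_le _ _).trans (by gcongr; exact hM n)
    have h₄ : ‖w n - T (w n)‖ * ‖w n - z k‖ ≤ ‖w n - T (w n)‖ * (M + ‖z k - p‖) := by gcongr
    linarith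
  have h₂ := le_of_mul_le_mul_left h₁ (hs k)
  have h₃ : inner ℝ (v - p) (w n - p) = inner ℝ (v - z k) (w n - z k)
      + inner ℝ (z k - p) (w n - p) + inner ℝ (v - z k) (z k - p) := by
    have e₁ : v - p = (v - z k) + (z k - p) := by abel
    have e₂ : inner ℝ (v - z k) (w n - p)
        = inner ℝ (v - z k) (w n - z k) + inner ℝ (v - z k) (z k - p) := by
      rw [← inner_add_right]
      congr 1
      abel
    rw [e₁, inner_add_left, e₂]
    ring
  have h₄ : inner ℝ (z k - p) (w n - p) ≤ ‖z k - p‖ * M :=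
    (real_inner_le_norm _ _).trans (by gcongr; exact hM n)
  have h₅ := real_inner_le_norm (v - z k) (z k - p)
  linarith

variable {G : H → H} {κ : ℝ≥0} {η : ℝ}

/-- The squared factor is at most `1 - 2 * l * η + l ^ 2 * κ ^ 2`, and the smallness of `l` gives `1
- l * η ≤ (1 - l * η / 2) ^ 2` as an upper bound. -/
theorem norm_gradient_step_le (hG : LipschitzWith κ G)
    (hmono : ∀ x y, η * ‖x - y‖ ^ 2 ≤ inner ℝ (G x - G y) (x - y)) {l : ℝ} (hl : 0 ≤ l)
    (hlκ : l * (κ : ℝ) ^ 2 ≤ η) (hlη : l * η ≤ 1) (x y : H) :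
    ‖(x - l • G x) - (y - l • G y)‖ ≤ (1 - l * (η / 2)) * ‖x - y‖ := by
  refine le_of_sq_le_sq ?_ (mul_nonneg (by linarith) (norm_nonneg _))
  have e : (x - l • G x) - (y - l • G y) = (x - y) - l • (G x - G y) := by module
  rw [e, norm_sub_sq_real, real_inner_smul_right, norm_smul, mul_pow, Real.norm_eq_abs, sq_abs,
    real_inner_comm]
  have h₁ := mul_le_mul_of_nonneg_left (hmono x y) hl
  have h₂ : ‖G x - G y‖ ^ 2 ≤ (κ : ℝ) ^ 2 * ‖x - y‖ ^ 2 := by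
    rw [← mul_pow]
    gcongr
    simpa [dist_eq_norm] using hG.dist_le_mul x y
  have h₃ : l ^ 2 * ‖G x - G y‖ ^ 2 ≤ l * (η * ‖x - y‖ ^ 2) := by
    calc l ^ 2 * ‖G x - G y‖ ^ 2 ≤ l ^ 2 * ((κ : ℝ) ^ 2 * ‖x - y‖ ^ 2) := by gcongr
      _ = l * ((l * (κ : ℝ) ^ 2) * ‖x - y‖ ^ 2) := by ring
      _ ≤ _ := by gcongr
  have h₄ : 0 ≤ (l * (η / 2)) ^ 2 * ‖x - y‖ ^ 2 := by positivity
  nlinarith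

/-- The variational inequality over the fixed point set of a nonexpansive mapping has a
solution. -/
theorem exists_variationalInequality_solution [CompleteSpace H] (hT : LipschitzWith 1 T)
    (hne : (Function.fixedPoints T).Nonempty) (hG : LipschitzWith κ G) (hη : 0 < η)
    (hmono : ∀ x y, η * ‖x - y‖ ^ 2 ≤ inner ℝ (G x - G y) (x - y)) :
    ∃ p ∈ Function.fixedPoints T, ∀ q ∈ Function.fixedPoints T, 0 ≤ inner ℝ (G p) (q - p) := by
  have hproj : ∀ v, ∃ p ∈ Function.fixedPoints T,
      ∀ q ∈ Function.fixedPoints T, inner ℝ (v - p) (q - p) ≤ 0 := by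
    intro v
    obtain ⟨_, _, p, _, _, _, hp, hq⟩ := exists_tendsto_regularized_fixedPoint hT hne v
    exact ⟨p, hp, hq⟩
  choose P hPfix hP using hproj
  have hPlip : ∀ a b, ‖P a - P b‖ ≤ ‖a - b‖ := by
    intro a b
    have h₁ := hP a (P b) (hPfix b)
    have h₂ := hP b (P a) (hPfix a)
    have h₃ : ‖P a - P b‖ ^ 2 ≤ inner ℝ (a - b) (P a - P b) := by
      have e : inner ℝ (a - b) (P a - P b) = -inner ℝ (a - P a) (P b - P a)
          - inner ℝ (b - P b) (P a - P b) + ‖P a - P b‖ ^ 2 := by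
        rw [← neg_sub (P a) (P b), inner_neg_right, neg_neg, ← inner_sub_left,
          ← real_inner_self_eq_norm_sq, ← inner_add_left]
        congr 1
        abel
      linarith
    have h₄ := real_inner_le_norm (a - b) (P a - P b)
    by_contra hcon
    push Not at hcon
    nlinarith [norm_nonneg (a - b)]
  set l : ℝ := min (η / ((κ : ℝ) ^ 2 + 1)) (1 / η) with hl
  have hl₀ : 0 < l := lt_min (by positivity) (by positivity)
  have hlκ : l * (κ : ℝ) ^ 2 ≤ η := by
    have h₁ : l * ((κ : ℝ) ^ 2 + 1) ≤ η :=
      (le_div_iff₀ (by positivity)).1 (min_le_left _ _)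
    nlinarith
  have hlη : l * η ≤ 1 := (le_div_iff₀ hη).1 (min_le_right _ _)
  have hρ : 0 ≤ 1 - l * (η / 2) := by linarith
  have hcontr : ContractingWith (Real.toNNReal (1 - l * (η / 2))) fun x => P (x - l • G x) := by
    refine ⟨?_, LipschitzWith.of_dist_le_mul fun a b => ?_⟩
    · rw [Real.toNNReal_lt_one]
      have : 0 < l * (η / 2) := by positivity
      linarith
    · rw [dist_eq_norm, dist_eq_norm, Real.coe_toNNReal _ hρ]
      exact (hPlip _ _).trans (norm_gradient_step_le hG hmono hl₀.le hlκ hlη a b)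
  have : Nonempty H := ⟨0⟩
  -- A fixed point of the projected gradient step solves the variational inequality.
  obtain ⟨p, hp⟩ : ∃ p, P (p - l • G p) = p := ⟨_, hcontr.fixedPoint_isFixedPt⟩
  refine ⟨p, hp ▸ hPfix _, fun q hq => ?_⟩
  have h := hP (p - l • G p) q hq
  rw [hp, sub_sub_cancel_left, inner_neg_left, real_inner_smul_left] at h
  have : 0 ≤ l * inner ℝ (G p) (q - p) := by linarith
  exact (mul_nonneg_iff_of_pos_left hl₀).1 this

/-- Strong convergence of the hybrid steepest descent method for small step sizes. -/
theorem tendsto_of_hybrid_recursion [CompleteSpace H] (hT : LipschitzWith 1 T)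
    (hG : LipschitzWith κ G) (hη : 0 < η)
    (hmono : ∀ x y, η * ‖x - y‖ ^ 2 ≤ inner ℝ (G x - G y) (x - y))
    {p : H} (hp : p ∈ Function.fixedPoints T)
    (hvi : ∀ q ∈ Function.fixedPoints T, 0 ≤ inner ℝ (G p) (q - p))
    {w : ℕ → H} {l δ β : ℕ → ℝ} (hw : ∀ n, w (n + 1) = T (w n) - l n • G (T (w n)))
    (hl₀ : ∀ n, 0 ≤ l n) (hlκ : ∀ n, l n * (κ : ℝ) ^ 2 ≤ η) (hlη : ∀ n, l n * η ≤ 1)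
    (hlim : Tendsto l atTop (𝓝 0))
    (hsum : Tendsto (fun n => ∑ i ∈ Finset.range n, l i) atTop atTop)
    (hδ : Tendsto δ atTop (𝓝 0)) (hβ₀ : ∀ n, 0 ≤ β n) (hβ : Summable β)
    (hvar : ∀ n, |l (n + 1) - l n| ≤ l (n + 1) * δ n + β n) :
    Tendsto w atTop (𝓝 p) := by
  have hTp : T p = p := hp
  set τ := η / 2 with hτ
  have hτ₀ : 0 < τ := by positivity
  have hstep : ∀ n x y, ‖(x - l n • G x) - (y - l n • G y)‖ ≤ (1 - l n * τ) * ‖x - y‖ :=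
    fun n => norm_gradient_step_le hG hmono (hl₀ n) (hlκ n) (hlη n)
  have hlτ : ∀ n, l n * τ ≤ 1 := fun n => by
    have h₁ := hlη n
    have h₂ := mul_nonneg (hl₀ n) hη.le
    rw [hτ]
    linarith
  have hTw : ∀ n, ‖T (w n) - p‖ ≤ ‖w n - p‖ := fun n => by
    have h := norm_sub_le_of_nonexpansive hT (w n) p
    rwa [hTp] at h
  have hcontr : ∀ n, ‖(T (w n) - l n • G (T (w n))) - (p - l n • G p)‖
      ≤ (1 - l n * τ) * ‖w n - p‖ := fun n =>
    (hstep n _ _).trans (mul_le_mul_of_nonneg_left (hTw n) (by linarith [hlτ n]))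
  have hsplit : ∀ n, w (n + 1) - p
      = ((T (w n) - l n • G (T (w n))) - (p - l n • G p)) + (-(l n)) • G p := fun n => by
    rw [hw]
    module
  -- boundedness
  set M := max ‖w 0 - p‖ (‖G p‖ / τ) with hMdef
  have hM : ∀ n, ‖w n - p‖ ≤ M := by
    intro n
    induction n with
    | zero => exact le_max_left _ _
    | succ n ih =>
      rw [hsplit]
      refine (norm_add_le _ _).trans ?_
      rw [norm_smul, norm_neg, Real.norm_of_nonneg (hl₀ n)]
      have h₁ := (hcontr n).trans (mul_le_mul_of_nonneg_left ih (by linarith [hlτ n]))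
      have h₂ : ‖G p‖ ≤ M * τ := (div_le_iff₀ hτ₀).1 (le_max_right _ _)
      have h₃ := mul_le_mul_of_nonneg_left h₂ (hl₀ n)
      linarith
  have hM₀ : 0 ≤ M := (norm_nonneg _).trans (hM 0)
  set B := κ * M + ‖G p‖ with hBdef
  have hB₀ : 0 ≤ B := by positivity
  have hB : ∀ n, ‖G (T (w n))‖ ≤ B := fun n => by
    have h₁ : ‖G (T (w n)) - G p‖ ≤ κ * ‖T (w n) - p‖ := by
      simpa [dist_eq_norm] using hG.dist_le_mul (T (w n)) p
    have h₂ : (κ : ℝ) * ‖T (w n) - p‖ ≤ κ * M := by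
      gcongr
      exact (hTw n).trans (hM n)
    have h₃ := norm_le_norm_sub_add (G (T (w n))) (G p)
    linarith
  have hγsum : Tendsto (fun n => ∑ i ∈ Finset.range n, l i * τ) atTop atTop := by
    simp only [← Finset.sum_mul]
    exact hsum.atTop_mul_const hτ₀
  -- asymptotic regularity
  have hreg : Tendsto (fun n => ‖w (n + 1) - w n‖) atTop (𝓝 0) := by
    refine tendsto_zero_of_le_one_sub_mul_add (γ := fun n => l (n + 1) * τ)
      (δ := fun n => δ n * (B / τ)) (β := fun n => β n * B) (fun n => norm_nonneg _)
      (fun n => mul_nonneg (hl₀ _) hτ₀.le) (fun n => hlτ _) ?_ ?_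
      (fun n => mul_nonneg (hβ₀ n) hB₀) (hβ.mul_right B) fun n => ?_
    · simpa only [add_comm] using tendsto_sum_range_shift hγsum 1
    · intro ε hε
      have h : Tendsto (fun n => δ n * (B / τ)) atTop (𝓝 0) := by
        simpa using hδ.mul_const (B / τ)
      exact (h.eventually (gt_mem_nhds hε)).mono fun n hn => hn.le
    -- Two steps are compared using the same step size `l (n + 1)`, which contracts; the change of
    -- step size is a separate error term controlled by `hvar`.
    · have e : w (n + 1 + 1) - w (n + 1)
          = ((T (w (n + 1)) - l (n + 1) • G (T (w (n + 1))))
            - (T (w n) - l (n + 1) • G (T (w n)))) - (l (n + 1) - l n) • G (T (w n)) := by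
        rw [hw (n + 1)]
        nth_rewrite 3 [hw n]
        module
      rw [e]
      refine (norm_sub_le _ _).trans ?_
      have h₁ := (hstep (n + 1) (T (w (n + 1))) (T (w n))).trans (mul_le_mul_of_nonneg_left
        (norm_sub_le_of_nonexpansive hT (w (n + 1)) (w n)) (by linarith [hlτ (n + 1)]))
      have h₂ : ‖(l (n + 1) - l n) • G (T (w n))‖ ≤ (l (n + 1) * δ n + β n) * B := by
        rw [norm_smul, Real.norm_eq_abs]
        exact mul_le_mul (hvar n) (hB n) (norm_nonneg _) ((abs_nonneg _).trans (hvar n))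
      have h₃ : l (n + 1) * τ * (δ n * (B / τ)) = l (n + 1) * δ n * B := by
        field_simp
      rw [h₃]
      linarith
  have happrox : Tendsto (fun n => w n - T (w n)) atTop (𝓝 0) := by
    refine squeeze_zero_norm (a := fun n => ‖w (n + 1) - w n‖ + l n * B) (fun n => ?_)
      (by simpa using hreg.add (hlim.mul_const B))
    have e : w n - T (w n) = -(w (n + 1) - w n) - l n • G (T (w n)) := by
      rw [hw]
      abel
    rw [e]
    refine (norm_sub_le _ _).trans ?_
    rw [norm_neg, norm_smul, Real.norm_of_nonneg (hl₀ n)]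
    gcongr
    · exact hl₀ n
    · exact hB n
  have hsq : Tendsto (fun n => ‖w n - p‖ ^ 2) atTop (𝓝 0) := by
    refine tendsto_zero_of_le_one_sub_mul_add (γ := fun n => l n * τ)
      (δ := fun n => 2 / τ * inner ℝ (-(G p)) (w (n + 1) - p)) (β := fun _ => 0)
      (fun n => sq_nonneg _) (fun n => mul_nonneg (hl₀ _) hτ₀.le) hlτ hγsum ?_
      (fun _ => le_rfl) summable_zero fun n => ?_
    · intro ε hε
      -- For `v = p - G p`, the variational inequality says exactly that `p` is the fixed point
      -- closest to `v`.
      have h := eventually_inner_le_of_approx_fixedPoint hT (v := p - G p) hp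
        (fun q hq => by
          rw [sub_sub_cancel_left, inner_neg_left]
          linarith [hvi q hq]) hM happrox (ε := ε * τ / 2) (by positivity)
      filter_upwards [(tendsto_add_atTop_nat 1).eventually h] with n hn
      rw [sub_sub_cancel_left] at hn
      calc 2 / τ * inner ℝ (-(G p)) (w (n + 1) - p) ≤ 2 / τ * (ε * τ / 2) := by gcongr
        _ = ε := by field_simp
    -- This is `‖a + b‖ ^ 2 ≤ ‖a‖ ^ 2 + 2 * inner ℝ b (a + b)`, which keeps the inner product at the
    -- new iterate.
    · have h₁ : ‖w (n + 1) - p‖ ^ 2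
          ≤ ‖(T (w n) - l n • G (T (w n))) - (p - l n • G p)‖ ^ 2
            + 2 * inner ℝ ((-(l n)) • G p) (w (n + 1) - p) := by
        have e := hsplit n
        generalize (T (w n) - l n • G (T (w n))) - (p - l n • G p) = a at *
        have ea : a = (w (n + 1) - p) - (-(l n)) • G p := by rw [e]; abel
        have := norm_sub_sq_real (w (n + 1) - p) ((-(l n)) • G p)
        rw [← ea, real_inner_comm] at this
        nlinarith [sq_nonneg ‖(-(l n)) • G p‖]
      have h₂ : ‖(T (w n) - l n • G (T (w n))) - (p - l n • G p)‖ ^ 2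
          ≤ (1 - l n * τ) * ‖w n - p‖ ^ 2 := by
        have h₃ := pow_le_pow_left₀ (norm_nonneg _) (hcontr n) 2
        have h₄ : 0 ≤ 1 - l n * τ := by linarith [hlτ n]
        have h₅ : (1 - l n * τ) ^ 2 ≤ 1 - l n * τ := by
          nlinarith [mul_nonneg (hl₀ n) hτ₀.le]
        calc _ ≤ _ := h₃
          _ = (1 - l n * τ) ^ 2 * ‖w n - p‖ ^ 2 := by ring
          _ ≤ _ := by gcongr
      have h₃ : l n * τ * (2 / τ * inner ℝ (-(G p)) (w (n + 1) - p))
          = 2 * inner ℝ ((-(l n)) • G p) (w (n + 1) - p) := by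
        rw [real_inner_smul_left, inner_neg_left]
        field_simp
      rw [h₃]
      linarith
  rw [tendsto_iff_norm_sub_tendsto_zero]
  have h := (Real.continuous_sqrt.tendsto 0).comp hsq
  rw [Real.sqrt_zero] at h
  refine h.congr fun n => ?_
  simp [Real.sqrt_sq]

/-- Strong convergence of the hybrid steepest descent method. -/
theorem tendsto_hsdm [CompleteSpace H] (hT : LipschitzWith 1 T)
    (hG : LipschitzWith κ G) (hη : 0 < η)
    (hmono : ∀ x y, η * ‖x - y‖ ^ 2 ≤ inner ℝ (G x - G y) (x - y))
    {p : H} (hp : p ∈ Function.fixedPoints T)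
    (hvi : ∀ q ∈ Function.fixedPoints T, 0 ≤ inner ℝ (G p) (q - p))
    {lam : ℕ → ℝ} (hlam : StepW lam ∨ StepL lam) (w₀ : H) :
    Tendsto (hsdm T G lam w₀) atTop (𝓝 p) := by
  have hnn : ∀ n, 0 ≤ lam (n + 1) :=
    hlam.elim (fun h => h.nonneg) fun h n => (h.pos n).le
  have hlim : Tendsto lam atTop (𝓝 0) := hlam.elim (fun h => h.w1) fun h => h.l1
  have hsum : Tendsto (fun N => ∑ n ∈ Finset.range N, lam (n + 1)) atTop atTop :=
    hlam.elim (fun h => h.w2) fun h => h.l2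
  -- One variation bound covers both step-size regimes: (W3) uses the summable part with `δ = 0`,
  -- and (L3) the relative part with `β = 0`.
  have hvar : ∃ δ β : ℕ → ℝ, Tendsto δ atTop (𝓝 0) ∧ (∀ n, 0 ≤ β n) ∧ Summable β ∧
      ∀ n, |lam (n + 2) - lam (n + 1)| ≤ lam (n + 2) * δ n + β n := by
    rcases hlam with h | h
    · refine ⟨fun _ => 0, fun n => |lam (n + 1) - lam (n + 2)|, tendsto_const_nhds,
        fun n => abs_nonneg _, h.w3, fun n => ?_⟩
      rw [mul_zero, zero_add, abs_sub_comm]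
    · refine ⟨fun n => |(lam (n + 1) - lam (n + 2)) / lam (n + 2) ^ 2| * lam (n + 2), fun _ => 0,
        ?_, fun _ => le_rfl, summable_zero, fun n => ?_⟩
      · have h₁ := (h.l3.comp (tendsto_add_atTop_nat 1)).abs
        have h₂ := h.l1.comp (tendsto_add_atTop_nat 2)
        simpa using h₁.mul h₂
      · have hpos := h.pos (n + 1)
        simp only [add_zero, abs_div, abs_of_pos (pow_pos hpos 2)]
        rw [abs_sub_comm]
        apply le_of_eq
        have : lam (n + 2) ≠ 0 := hpos.ne'
        field_simp
  obtain ⟨δ, β, hδ, hβ₀, hβ, hvar⟩ := hvar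
  have hsmall : ∀ᶠ n in atTop, lam n * (κ : ℝ) ^ 2 ≤ η ∧ lam n * η ≤ 1 := by
    have h₁ : Tendsto (fun n => lam n * (κ : ℝ) ^ 2) atTop (𝓝 0) := by
      simpa using hlim.mul_const ((κ : ℝ) ^ 2)
    have h₂ : Tendsto (fun n => lam n * η) atTop (𝓝 0) := by simpa using hlim.mul_const η
    filter_upwards [h₁.eventually (gt_mem_nhds hη), h₂.eventually (gt_mem_nhds one_pos)]
      with n hn₁ hn₂ using ⟨hn₁.le, hn₂.le⟩
  obtain ⟨N, hN⟩ := eventually_atTop.1 hsmall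
  -- Dropping `N` terms makes all step sizes small enough for contraction; the tail is again a run
  -- of the method.
  refine (tendsto_add_atTop_iff_nat N).1 ?_
  refine tendsto_of_hybrid_recursion hT hG hη hmono hp hvi (l := fun n => lam (n + N + 1))
    (δ := fun n => δ (n + N)) (β := fun n => β (n + N)) (fun n => ?_) (fun n => hnn _)
    (fun n => (hN _ (by omega)).1) (fun n => (hN _ (by omega)).2) ?_ ?_
    (hδ.comp (tendsto_add_atTop_nat N)) (fun n => hβ₀ _) ((summable_nat_add_iff N).2 hβ)
    fun n => ?_
  · rw [show n + 1 + N = (n + N) + 1 by ring]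
    rfl
  · exact hlim.comp (tendsto_add_atTop_nat (N + 1))
  · simpa only [add_comm N] using tendsto_sum_range_shift hsum N
  · rw [show n + 1 + N + 1 = n + N + 2 by ring]
    exact hvar (n + N)

end Nonexpansive

/-! ### Gâteaux gradients, relaxation and minimizers over fixed points. -/

section GateauxGradient

variable {H : Type*} [NormedAddCommGroup H] [InnerProductSpace ℝ H]

theorem HasGateauxGradientAt.hasDerivAt_line {φ : H → ℝ} {G : H → H}
    (hφ : ∀ w, HasGateauxGradientAt φ (G w) w) (w d : H) (t : ℝ) :
    HasDerivAt (fun s : ℝ => φ (w + s • d)) (inner ℝ (G (w + t • d)) d) t := by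
  have h : HasDerivAt (fun s : ℝ => φ (w + t • d + s • d)) (inner ℝ (G (w + t • d)) d) (t - t) := by
    rw [sub_self]
    exact hφ (w + t • d) d
  refine (h.comp_sub_const t t).congr_of_eventuallyEq (Eventually.of_forall fun s => ?_)
  change φ (w + s • d) = φ (w + t • d + (s - t) • d)
  congr 1
  module

/-- A function with strongly monotone Gâteaux gradient lies strictly above its tangents. -/
theorem add_inner_lt_of_stronglyMonotone {φ : H → ℝ} {G : H → H}
    (hφ : ∀ w, HasGateauxGradientAt φ (G w) w) (hG : StronglyMonotone G) {w z : H}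
    (hne : z ≠ w) : φ w + inner ℝ (G w) (z - w) < φ z := by
  obtain ⟨η, hη, hmono⟩ := hG
  have hder := HasGateauxGradientAt.hasDerivAt_line hφ w (z - w)
  obtain ⟨t, ⟨ht₀, -⟩, ht⟩ := exists_hasDerivAt_eq_slope _ _ zero_lt_one
    (fun s _ => (hder s).continuousAt.continuousWithinAt) fun s _ => hder s
  have e₁ : w + (1 : ℝ) • (z - w) = z := by module
  have e₀ : w + (0 : ℝ) • (z - w) = w := by module
  rw [e₁, e₀, sub_zero, div_one] at ht
  have h := hmono (w + t • (z - w)) w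
  rw [add_sub_cancel_left, real_inner_smul_right, norm_smul, mul_pow, Real.norm_eq_abs, sq_abs,
    inner_sub_left, ht] at h
  have hpos : 0 < η * (t ^ 2 * ‖z - w‖ ^ 2) := by
    have := norm_pos_iff.2 (sub_ne_zero.2 hne)
    positivity
  have := pos_of_mul_pos_right (hpos.trans_le h) ht₀.le
  linarith

theorem lipschitzWith_relax {T : H → H} (hT : LipschitzWith 1 T) {α : ℝ} (hα₀ : 0 < α)
    (hα₁ : α ≤ 1) : LipschitzWith 1 (relax α T) := by
  refine LipschitzWith.of_dist_le_mul fun a b => ?_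
  rw [NNReal.coe_one, one_mul, dist_eq_norm, dist_eq_norm]
  have e : relax α T a - relax α T b = (1 - α) • (a - b) + α • (T a - T b) := by
    simp only [relax]
    module
  rw [e]
  refine (norm_add_le _ _).trans ?_
  rw [norm_smul, norm_smul, Real.norm_of_nonneg hα₀.le, Real.norm_of_nonneg (by linarith)]
  have := mul_le_mul_of_nonneg_left (norm_sub_le_of_nonexpansive hT a b) hα₀.le
  linarith

theorem fixedPoints_relax (T : H → H) {α : ℝ} (hα : 0 < α) :
    Function.fixedPoints (relax α T) = Function.fixedPoints T := by
  ext w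
  change relax α T w = w ↔ T w = w
  have e : relax α T w - w = α • (T w - w) := by
    simp only [relax]
    module
  rw [← sub_eq_zero, e, smul_eq_zero, or_iff_right hα.ne', sub_eq_zero]

theorem argminOn_fixedPoints_eq_singleton {T : H → H} {φ : H → ℝ} {G : H → H}
    (hφ : ∀ w, HasGateauxGradientAt φ (G w) w) (hG : StronglyMonotone G) {p : H}
    (hp : p ∈ Function.fixedPoints T)
    (hvi : ∀ q ∈ Function.fixedPoints T, 0 ≤ inner ℝ (G p) (q - p)) :
    argminOn φ (Function.fixedPoints T) = {p} := by
  have hlt : ∀ q ∈ Function.fixedPoints T, q ≠ p → φ p < φ q := fun q hq hne => by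
    have h₁ := add_inner_lt_of_stronglyMonotone hφ hG hne
    have h₂ := hvi q hq
    linarith
  ext q
  rw [mem_singleton_iff]
  constructor
  · rintro ⟨hq, hmin⟩
    by_contra hne
    exact absurd (hmin hp) (not_le.2 (hlt q hq hne))
  · rintro rfl
    refine ⟨hp, fun z hz => ?_⟩
    change φ q ≤ φ z
    rcases eq_or_ne z q with rfl | hne
    · exact le_rfl
    · exact (hlt z hz hne).le

end GateauxGradient

/-! ### The regularized objective and its hierarchical meaning. -/

section RegularizedObjective

variable {X K : Type*} [NormedAddCommGroup X] [InnerProductSpace ℝ X] [CompleteSpace X]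
  [NormedAddCommGroup K] [InnerProductSpace ℝ K] [CompleteSpace K]
  {Ψ : X → ℝ} {gradΨ : X → X} {A : X →L[ℝ] K} {ηxy ην : ℝ}

/-- The gradient of the regularized objective. -/
noncomputable def thetaGrad (gradΨ : X → X) (A : X →L[ℝ] K) (ηxy ην : ℝ) (w : Triple X K) :
    Triple X K :=
  triple (gradΨ (xPart w) + ηxy • A.adjoint (A (xPart w) - yPart w))
    (-(ηxy • (A (xPart w) - yPart w))) (ην • nuPart w)

theorem hasGateauxGradientAt_thetaReg (hgrad : ∀ x, HasGateauxGradientAt Ψ (gradΨ x) x)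
    (w : Triple X K) :
    HasGateauxGradientAt (thetaReg Ψ A ηxy ην) (thetaGrad gradΨ A ηxy ην w) w := by
  intro h
  have hline : ∀ {F : Type _} [NormedAddCommGroup F] [InnerProductSpace ℝ F] (a b : F),
      HasDerivAt (fun t : ℝ => ‖a + t • b‖ ^ 2) (2 * inner ℝ a b) 0 := by
    intro F _ _ a b
    have h₁ : HasDerivAt (fun t : ℝ => a + t • b) b 0 := by
      simpa using ((hasDerivAt_id (0 : ℝ)).smul_const b).const_add a
    simpa using h₁.norm_sq
  have h₁ : HasDerivAt (fun t : ℝ => Ψ (xPart w + t • xPart h))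
    (inner ℝ (gradΨ (xPart w)) (xPart h)) 0 := hgrad (xPart w) (xPart h)
  have h₂ := (hline (A (xPart w) - yPart w) (A (xPart h) - yPart h)).const_mul (ηxy / 2)
  have h₃ := (hline (nuPart w) (nuPart h)).const_mul (ην / 2)
  have h₄ := (h₁.add h₂).add h₃
  have hval : inner ℝ (thetaGrad gradΨ A ηxy ην w) h
      = inner ℝ (gradΨ (xPart w)) (xPart h)
        + ηxy / 2 * (2 * inner ℝ (A (xPart w) - yPart w) (A (xPart h) - yPart h))
        + ην / 2 * (2 * inner ℝ (nuPart w) (nuPart h)) := by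
    rw [inner_triple]
    simp only [thetaGrad, xPart_triple, yPart_triple, nuPart_triple]
    rw [inner_add_left, real_inner_smul_left, inner_neg_left, real_inner_smul_left,
      real_inner_smul_left, ContinuousLinearMap.adjoint_inner_left, inner_sub_right _ (A (xPart h))]
    ring
  rw [hval]
  refine h₄.congr_of_eventuallyEq (Eventually.of_forall fun t => ?_)
  have e : A (xPart w + t • xPart h) - (yPart w + t • yPart h)
      = A (xPart w) - yPart w + t • (A (xPart h) - yPart h) := by
    rw [map_add, map_smul]
    module
  change thetaReg Ψ A ηxy ην (w + t • h) = Ψ (xPart w + t • xPart h)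
    + ηxy / 2 * ‖A (xPart w) - yPart w + t • (A (xPart h) - yPart h)‖ ^ 2
    + ην / 2 * ‖nuPart w + t • nuPart h‖ ^ 2
  rw [thetaReg, checkA_fst, xPart_add, yPart_add, nuPart_add, xPart_smul, yPart_smul, nuPart_smul,
    e]

theorem thetaGrad_sub (w w' : Triple X K) :
    thetaGrad gradΨ A ηxy ην w - thetaGrad gradΨ A ηxy ην w'
      = triple (gradΨ (xPart w) - gradΨ (xPart w')
          + ηxy • A.adjoint (A (xPart (w - w')) - yPart (w - w')))
        (-(ηxy • (A (xPart (w - w')) - yPart (w - w')))) (ην • nuPart (w - w')) := by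
  refine triple_ext ?_ ?_ ?_ <;>
  · simp only [thetaGrad, xPart_sub, yPart_sub, nuPart_sub, xPart_triple, yPart_triple,
      nuPart_triple, map_sub]
    module

theorem exists_lipschitzWith_thetaGrad (hlip : ∃ κ : ℝ≥0, LipschitzWith κ gradΨ) :
    ∃ κ : ℝ≥0, LipschitzWith κ (thetaGrad gradΨ A ηxy ην) := by
  obtain ⟨κ, hκ⟩ := hlip
  refine ⟨_, LipschitzWith.of_dist_le' (K := κ + |ηxy| * (‖A.adjoint‖ * (‖A‖ + 1))
    + |ηxy| * (‖A‖ + 1) + |ην|) fun w w' => ?_⟩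
  rw [dist_eq_norm, dist_eq_norm, thetaGrad_sub]
  have hnorm : ∀ (a : X) (b c : K), ‖triple a b c‖ ≤ ‖a‖ + ‖b‖ + ‖c‖ := by
    intro a b c
    refine le_of_sq_le_sq ?_ (by positivity)
    rw [norm_sq_triple, xPart_triple, yPart_triple, nuPart_triple]
    nlinarith [mul_nonneg (norm_nonneg a) (norm_nonneg b),
      mul_nonneg (norm_nonneg a) (norm_nonneg c), mul_nonneg (norm_nonneg b) (norm_nonneg c)]
  have hsq := norm_sq_triple (w - w')
  have hx : ‖xPart (w - w')‖ ≤ ‖w - w'‖ := le_of_sq_le_sq (by nlinarith) (norm_nonneg _)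
  have hy : ‖yPart (w - w')‖ ≤ ‖w - w'‖ := le_of_sq_le_sq (by nlinarith) (norm_nonneg _)
  have hν : ‖nuPart (w - w')‖ ≤ ‖w - w'‖ := le_of_sq_le_sq (by nlinarith) (norm_nonneg _)
  have hr : ‖A (xPart (w - w')) - yPart (w - w')‖ ≤ (‖A‖ + 1) * ‖w - w'‖ := by
    refine (norm_sub_le _ _).trans ?_
    have := (A.le_opNorm (xPart (w - w'))).trans (mul_le_mul_of_nonneg_left hx (norm_nonneg A))
    linarith
  have hg : ‖gradΨ (xPart w) - gradΨ (xPart w')‖ ≤ κ * ‖w - w'‖ := by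
    have h := hκ.dist_le_mul (xPart w) (xPart w')
    rw [dist_eq_norm, dist_eq_norm, ← xPart_sub] at h
    exact h.trans (by gcongr)
  refine (hnorm _ _ _).trans ?_
  rw [norm_neg, norm_smul, norm_smul, Real.norm_eq_abs, Real.norm_eq_abs]
  have h₁ : ‖gradΨ (xPart w) - gradΨ (xPart w')
      + ηxy • A.adjoint (A (xPart (w - w')) - yPart (w - w'))‖
      ≤ κ * ‖w - w'‖ + |ηxy| * (‖A.adjoint‖ * ((‖A‖ + 1) * ‖w - w'‖)) := by
    refine (norm_add_le _ _).trans (add_le_add hg ?_)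
    rw [norm_smul, Real.norm_eq_abs]
    gcongr
    exact (A.adjoint.le_opNorm _).trans (by gcongr)
  have h₂ := mul_le_mul_of_nonneg_left hr (abs_nonneg ηxy)
  have h₃ := mul_le_mul_of_nonneg_left hν (abs_nonneg ην)
  linarith

/-- The coupling term controls only `A a - b`, but strong monotonicity in `a` recovers `b` through
`‖b‖ ^ 2 ≤ 2 * ‖A a - b‖ ^ 2 + 2 * ‖A‖ ^ 2 * ‖a‖ ^ 2`; the constant `c` balances these
contributions. -/
theorem stronglyMonotone_thetaGrad (hmono : StronglyMonotone gradΨ) (hηxy : 0 < ηxy)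
    (hην : 0 < ην) : StronglyMonotone (thetaGrad gradΨ A ηxy ην) := by
  obtain ⟨η, hη, hmono⟩ := hmono
  set c : ℝ := min (η / (1 + 2 * ‖A‖ ^ 2)) (min (ηxy / 2) ην) with hc
  have hc₀ : 0 < c := lt_min (by positivity) (lt_min (by positivity) hην)
  have hc₁ : c * (1 + 2 * ‖A‖ ^ 2) ≤ η := (le_div_iff₀ (by positivity)).1 (min_le_left _ _)
  have hc₂ : c ≤ ηxy / 2 := (min_le_right _ _).trans (min_le_left _ _)
  have hc₃ : c ≤ ην := (min_le_right _ _).trans (min_le_right _ _)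
  refine ⟨c, hc₀, fun w w' => ?_⟩
  rw [thetaGrad_sub, inner_triple, norm_sq_triple]
  simp only [xPart_triple, yPart_triple, nuPart_triple]
  have h₁ := hmono (xPart w) (xPart w')
  rw [← xPart_sub] at h₁
  rw [inner_add_left, real_inner_smul_left, inner_neg_left, real_inner_smul_left,
    real_inner_smul_left, ContinuousLinearMap.adjoint_inner_left, real_inner_self_eq_norm_sq]
  generalize gradΨ (xPart w) - gradΨ (xPart w') = D at *
  generalize xPart (w - w') = a at *
  generalize yPart (w - w') = b at *
  generalize nuPart (w - w') = n at *
  have e : inner ℝ (A a - b) (A a) - inner ℝ (A a - b) b = ‖A a - b‖ ^ 2 := by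
    rw [← inner_sub_right, real_inner_self_eq_norm_sq]
  have hb : ‖b‖ ^ 2 ≤ 2 * ‖A a - b‖ ^ 2 + 2 * (‖A‖ ^ 2 * ‖a‖ ^ 2) := by
    have h₂ : ‖b‖ ≤ ‖A a - b‖ + ‖A‖ * ‖a‖ := by
      have h₃ : ‖b‖ ≤ ‖A a‖ + ‖A a - b‖ := norm_le_norm_add_norm_sub _ _
      have h₄ := A.le_opNorm a
      linarith
    have h₅ := pow_le_pow_left₀ (norm_nonneg b) h₂ 2
    nlinarith [sq_nonneg (‖A a - b‖ - ‖A‖ * ‖a‖)]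
  have i₁ := mul_le_mul_of_nonneg_right hc₁ (sq_nonneg ‖a‖)
  have i₂ := mul_le_mul_of_nonneg_right hc₂ (sq_nonneg ‖A a - b‖)
  have i₃ := mul_le_mul_of_nonneg_right hc₃ (sq_nonneg ‖n‖)
  have i₄ := mul_le_mul_of_nonneg_left hb hc₀.le
  have i₅ : ηxy * inner ℝ (A a - b) (A a) - ηxy * inner ℝ (A a - b) b
      = ηxy * ‖A a - b‖ ^ 2 := by rw [← mul_sub, e]
  linarith

theorem lalHSDM_eq_hsdm (f : X → EReal) (g : K → EReal) (u α : ℝ) (lam : ℕ → ℝ)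
    (w₀ : Triple X K) : lalHSDM f g A u gradΨ α ηxy ην lam w₀
      = hsdm (relax α (lalOp f g A u)) (thetaGrad gradΨ A ηxy ην) lam w₀ := by
  funext n
  induction n with
  | zero => rfl
  | succ n ih =>
    rw [lalHSDM, hsdm, ← ih]
    refine triple_ext ?_ ?_ ?_
    · rfl
    · simp only [relax, thetaGrad, yPart_sub, yPart_smul, yPart_triple]
      module
    · simp only [relax, thetaGrad, nuPart_sub, nuPart_smul, nuPart_triple]
      module

/-- The regularized problem over the fixed point set has a unique solution, and its first
component is the unique minimizer of `Ψ` over the solution set. -/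
theorem exists_regularized_solution {f : X → EReal} (hf : IsGamma0 f) {g : K → EReal}
    (hg : IsGamma0 g) (hS : (solSet f g A).Nonempty) (hq : Qualified f g A)
    {u : ℝ} (hu : 0 < u) (hA : ‖checkA A‖ ≤ 1 / u)
    (hgrad : ∀ x, HasGateauxGradientAt Ψ (gradΨ x) x)
    (hlip : ∃ κ : ℝ≥0, LipschitzWith κ gradΨ) (hmono : StronglyMonotone gradΨ)
    (hηxy : 0 < ηxy) (hην : 0 < ην) :
    ∃ p ∈ Function.fixedPoints (lalOp f g A u),
      (∀ q ∈ Function.fixedPoints (lalOp f g A u),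
        0 ≤ inner ℝ (thetaGrad gradΨ A ηxy ην p) (q - p)) ∧
      argminOn (thetaReg Ψ A ηxy ην) (Function.fixedPoints (lalOp f g A u)) = {p} ∧
      argminOn Ψ (solSet f g A) = {xPart p} := by
  have hsol := solSet_eq_image_fixedPoints hf hg hq hu
  have hne : (Function.fixedPoints (lalOp f g A u)).Nonempty := by
    rw [hsol] at hS
    exact hS.of_image
  obtain ⟨κ, hκ⟩ := exists_lipschitzWith_thetaGrad (A := A) (ηxy := ηxy) (ην := ην) hlip
  have hsm := stronglyMonotone_thetaGrad (A := A) hmono hηxy hην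
  obtain ⟨η, hη, hη'⟩ := id hsm
  obtain ⟨p, hp, hvi⟩ := exists_variationalInequality_solution
    (lipschitzWith_lalOp hf hg hu hA) hne hκ hη hη'
  have harg := argminOn_fixedPoints_eq_singleton
    (fun w => hasGateauxGradientAt_thetaReg hgrad w) hsm hp hvi
  refine ⟨p, hp, hvi, harg, ?_⟩
  obtain ⟨hpy, hkkt⟩ := (mem_fixedPoints_lalOp_iff hf hg hu p).1 hp
  have hθ : ∀ x, thetaReg Ψ A ηxy ην (triple x (A x) (nuPart p))
      = Ψ x + ην / 2 * ‖nuPart p‖ ^ 2 := fun x => by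
    rw [thetaReg, checkA_fst, xPart_triple, yPart_triple, nuPart_triple, sub_self, norm_zero]
    ring
  have hptriple : triple (xPart p) (A (xPart p)) (nuPart p) = p := triple_ext rfl hpy.symm rfl
  -- Every solution lifts to a fixed point with the same multiplier as `p`; on these lifts
  -- `thetaReg` differs from `Ψ` by a constant.
  have hfix : ∀ x ∈ solSet f g A,
      triple x (A x) (nuPart p) ∈ Function.fixedPoints (lalOp f g A u) := fun x hx =>
    (mem_fixedPoints_lalOp_iff hf hg hu _).2 ⟨rfl, hkkt.of_mem_solSet hf hg hq hx⟩
  have hpmin : p ∈ argminOn (thetaReg Ψ A ηxy ην) (Function.fixedPoints (lalOp f g A u)) := by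
    rw [harg]
    rfl
  have hle : ∀ x ∈ solSet f g A, Ψ (xPart p) ≤ Ψ x := fun x hx => by
    have h : thetaReg Ψ A ηxy ην p ≤ thetaReg Ψ A ηxy ην (triple x (A x) (nuPart p)) :=
      hpmin.2 (hfix x hx)
    rw [← hptriple, hθ, nuPart_triple, hθ] at h
    linarith
  have hps : xPart p ∈ solSet f g A := hsol ▸ ⟨p, hp, rfl⟩
  ext x
  rw [mem_singleton_iff]
  constructor
  · rintro ⟨hx, hxmin⟩
    have hxp : Ψ x ≤ Ψ (xPart p) := hxmin hps
    -- The lift of another minimizer of `Ψ` also minimizes `thetaReg`, so it equals `p`.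
    have hmem : triple x (A x) (nuPart p) ∈
        argminOn (thetaReg Ψ A ηxy ην) (Function.fixedPoints (lalOp f g A u)) := by
      refine ⟨hfix x hx, fun z hz => ?_⟩
      have h₁ : thetaReg Ψ A ηxy ην p ≤ thetaReg Ψ A ηxy ην z := hpmin.2 hz
      rw [← hptriple, hθ] at h₁
      change thetaReg Ψ A ηxy ην (triple x (A x) (nuPart p)) ≤ thetaReg Ψ A ηxy ην z
      rw [hθ]
      linarith
    rw [harg, mem_singleton_iff] at hmem
    exact congrArg xPart hmem
  · rintro rfl
    exact ⟨hps, fun x hx => hle x hx⟩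

end RegularizedObjective

end LAL

/-! ### The main theorem. -/

theorem theorem3 {X K : Type*}
    [NormedAddCommGroup X] [InnerProductSpace ℝ X] [CompleteSpace X]
    [NormedAddCommGroup K] [InnerProductSpace ℝ K] [CompleteSpace K]
    (f : X → EReal) (hf : IsGamma0 f) (g : K → EReal) (hg : IsGamma0 g)
    (A : X →L[ℝ] K) (hS : (solSet f g A).Nonempty) (hq : Qualified f g A)
    (u : ℝ) (hu : 0 < u) (hA : ‖checkA A‖ ≤ 1 / u)
    (Ψ : X → ℝ) (hΨ : IsGamma0 fun x => (Ψ x : EReal))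
    (gradΨ : X → X) (hgrad : ∀ x, HasGateauxGradientAt Ψ (gradΨ x) x)
    (hlip : ∃ κ : ℝ≥0, LipschitzWith κ gradΨ) (hmono : StronglyMonotone gradΨ) :
    -- the proximity operators entering the LAL operator are well defined
    (∀ x, argminOn (proxObjective f x) univ = {prox f x}) ∧
    (∀ y, argminOn (proxObjective g y) univ = {prox g y}) ∧
    -- the LAL operator is nonexpansive and characterizes the solution set
    LipschitzWith 1 (lalOp f g A u) ∧
    solSet f g A = xPart '' Function.fixedPoints (lalOp f g A u) ∧
    -- the hierarchical problem has exactly one solution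
    ∃ xstar : X, argminOn Ψ (solSet f g A) = {xstar} ∧
      ∀ α : ℝ, 0 < α → α ≤ 1 → ∀ ηxy ην : ℝ, 0 < ηxy → 0 < ην →
        -- the LAL operator can be plugged into the hybrid steepest descent method
        LipschitzWith 1 (relax α (lalOp f g A u)) ∧
        solSet f g A = xPart '' Function.fixedPoints (relax α (lalOp f g A u)) ∧
        {xstar} = xPart '' argminOn (thetaReg Ψ A ηxy ην)
          (Function.fixedPoints (relax α (lalOp f g A u))) ∧
        (∃ G : Triple X K → Triple X K,
          (∀ w, HasGateauxGradientAt (thetaReg Ψ A ηxy ην) (G w) w) ∧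
          (∃ κ : ℝ≥0, LipschitzWith κ G) ∧ StronglyMonotone G ∧
          ∀ (lam : ℕ → ℝ) (w₀ : Triple X K),
            lalHSDM f g A u gradΨ α ηxy ην lam w₀
              = hsdm (relax α (lalOp f g A u)) G lam w₀) ∧
        -- strong convergence
        ∀ lam : ℕ → ℝ, StepW lam ∨ StepL lam → ∀ (x₀ : X) (y₀ ν₀ : K),
          Tendsto (fun n => xPart (lalHSDM f g A u gradΨ α ηxy ην lam (triple x₀ y₀ ν₀) n))
            atTop (𝓝 xstar) := by
  have hsol := solSet_eq_image_fixedPoints hf hg hq hu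
  have hT := lipschitzWith_lalOp hf hg hu hA
  refine ⟨argminOn_proxObjective hf, argminOn_proxObjective hg, hT, hsol, ?_⟩
  -- The solution must be named before the weights are given, so both weights are set to `1` here;
  -- uniqueness of the minimizer of `Ψ` identifies it with the one for arbitrary weights.
  obtain ⟨p₁, -, -, -, hΨ₁⟩ := exists_regularized_solution hf hg hS hq hu hA hgrad hlip hmono
    one_pos one_pos
  refine ⟨xPart p₁, hΨ₁, fun α hα₀ hα₁ ηxy ην hηxy hην => ?_⟩
  obtain ⟨p, hp, hvi, harg, hΨp⟩ :=
    exists_regularized_solution hf hg hS hq hu hA hgrad hlip hmono hηxy hην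
  have hxp : xPart p₁ = xPart p := singleton_eq_singleton_iff.1 (hΨ₁.symm.trans hΨp)
  have hTα := lipschitzWith_relax hT hα₀ hα₁
  have hfix := fixedPoints_relax (lalOp f g A u) hα₀
  have hLip := exists_lipschitzWith_thetaGrad (A := A) (ηxy := ηxy) (ην := ην) hlip
  have hsm := stronglyMonotone_thetaGrad (A := A) hmono hηxy hην
  refine ⟨hTα, by rw [hfix, hsol], by rw [hfix, harg, image_singleton, hxp],
    ⟨thetaGrad gradΨ A ηxy ην, hasGateauxGradientAt_thetaReg hgrad, hLip, hsm,
      lalHSDM_eq_hsdm f g u α⟩, fun lam hlam x₀ y₀ ν₀ => ?_⟩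
  obtain ⟨κ, hκ⟩ := hLip
  obtain ⟨η, hη, hη'⟩ := hsm
  rw [← hfix] at hp hvi
  rw [lalHSDM_eq_hsdm, hxp]
  exact (continuous_xPart.tendsto p).comp
    (tendsto_hsdm hTα hκ hη hη' hp hvi hlam (triple x₀ y₀ ν₀))
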